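/- Let $\phi,\theta:\mathbb R\to\mathbb R$ be locally absolutely continuous with $\phi\in L^\infty(\mathbb R)\cap L^1(\mathbb R)$, $\phi'\in L^\infty(\mathbb R)$, $\theta\in L^\infty(\mathbb R)$, $\theta'\in L^\infty(\mathbb R)\cap L^1(\mathbb R)$, $\lim_{t\to\infty}\theta(t)=1$ and $\lim_{t\to-\infty}\theta(t)=0$. In the complex Hilbert space $L^2(\mathbb R^2)=L^2(\mathbb R^2;dt\,dx)$ let $d/dt$ be the weak derivative in $t$ and $\boldsymbol A_-=-i\,d/dx$, each on its maximal domain, and let $\boldsymbol B$ and $\boldsymbol B'$ be the (bounded) operators of multiplication by $\theta(t)\phi(x)$ and $\theta'(t)\phi(x)$. Put $$\boldsymbol D=\frac{d}{dt}+\boldsymbol A_-+\boldsymbol B,\quad \mathrm{dom}(\boldsymbol D)=W^{1,2}(\mathbb R^2),\qquad \boldsymbol H_1=\boldsymbol D^*\boldsymbol D,\qquad \boldsymbol H_2=\boldsymbol D\boldsymbol D^*,$$ and $\boldsymbol H_0=-\frac{d^2}{dt^2}+\boldsymbol A_-^2=-\Delta$ with $\mathrm{dom}(\boldsymbol H_0)=W^{2,2}(\mathbb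 R^2)$. For $n\in\mathbb N=\{1,2,\dots\}$ let $\chi_n(\nu)=n(\nu^2+n^2)^{-1/2}$, $\nu\in\mathbb R$, and $$\boldsymbol B_n=\chi_n(\boldsymbol A_-)\boldsymbol B\chi_n(\boldsymbol A_-),\qquad \boldsymbol B_n'=\chi_n(\boldsymbol A_-)\boldsymbol B'\chi_n(\boldsymbol A_-),$$ $$\boldsymbol H_{j,n}=\boldsymbol H_0+\boldsymbol B_n\boldsymbol A_-+\boldsymbol A_-\boldsymbol B_n+\boldsymbol B_n^2+(-1)^j\boldsymbol B_n', \quad \mathrm{dom}(\boldsymbol H_{j,n})=W^{2,2}(\mathbb R^2),\quad j=1,2.$$ For $p\ge 1$ let $\|T\|_{\mathcal B_p}$ be the $\ell^p$-norm of the singular values of a bounded operator $T$ on $L^2(\mathbb R^2)$, so that $\|\cdot\|_{\mathcal B_2}$ is the Hilbert–Schmidt norm and $\|\cdot\|_{\mathcal B_1}$ the trace norm, and let $\mathcal B_p$ be the set of all $T$ with $\|T\|_{\mathcal B_p}<\infty$. Let $z,z'\in\mathbb C\setminus[0,\infty)$ and $j\in\{1,2\}$. Then $z$ and $z'$ belong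 to the resolvent sets of $\boldsymbol H_j$ and of $\boldsymbol H_{j,n}$ for every $n\in\mathbb N$; the operators $\boldsymbol B'(\boldsymbol H_j-z)^{-1}$ and $\boldsymbol B_n'(\boldsymbol H_{j,n}-z)^{-1}$ are in $\mathcal B_2$, the operators $(\boldsymbol H_j-z)^{-1}2\boldsymbol B'(\boldsymbol H_j-z')^{-1}$ and $(\boldsymbol H_{j,n}-z)^{-1}2\boldsymbol B_n'(\boldsymbol H_{j,n}-z')^{-1}$ are in $\mathcal B_1$, and $$\lim_{n\to\infty}\big\|\boldsymbol B_n'(\boldsymbol H_{j,n}-z)^{-1}-\boldsymbol B'(\boldsymbol H_j-z)^{-1}\big\|_{\mathcal B_2}=0,$$ $$\lim_{n\to\infty}\big\|(\boldsymbol H_{j,n}-z)^{-1}2\boldsymbol B_n'(\boldsymbol H_{j,n}-z')^{-1} -(\boldsymbol H_j-z)^{-1}2\boldsymbol B'(\boldsymbol H_j-z')^{-1}\big\|_{\mathcal B_1}=0.$$ -/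

import Mathlib

open MeasureTheory Filter Topology FourierTransform LineDeriv
open scoped ENNReal SchwartzMap

namespace DiracSchrodinger

/-! ### Schatten norms -/

section Schatten

variable {H : Type*} [NormedAddCommGroup H] [InnerProductSpace ℂ H]

/-- The singular values `s₀(T) ≥ s₁(T) ≥ …` of a bounded operator on a Hilbert space, as the
distances of `T` to the operators of rank at most `n`. For compact `T` these are the eigenvalues of
`|T|` in decreasing order, counted with multiplicity; for non-compact `T` they do not tend to `0`,
so that the Schatten norms below are infinite. -/
noncomputable def singularValue (T : H →L[ℂ] H) (n : ℕ) : ℝ≥0∞ :=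
  ⨅ F : {F : H →L[ℂ] H // LinearMap.rank (F : H →ₗ[ℂ] H) ≤ n}, ‖T - F.1‖ₑ

/-- The norm of the trace ideal `𝓑_p`: the `ℓ^p`-norm of the singular values, with value `∞`
exactly when the operator is not in `𝓑_p`. -/
noncomputable def schattenNorm (p : ℝ) (T : H →L[ℂ] H) : ℝ≥0∞ :=
  (∑' n, singularValue T n ^ p) ^ (1 / p)

end Schatten

/-! ### Unbounded operators -/

section Unbounded

variable {H : Type*} [NormedAddCommGroup H] [InnerProductSpace ℂ H]

/-- The product `S T` of two partially defined operators on its natural domain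
`{f ∈ dom T | T f ∈ dom S}`. -/
def opComp (S T : H →ₗ.[ℂ] H) : H →ₗ.[ℂ] H where
  domain := (S.domain.comap T.toFun).map T.domain.subtype
  toFun :=
    { toFun := fun f ↦ S ⟨T ⟨f.1, by
          obtain ⟨g, _, hg⟩ := f.2
          exact hg ▸ g.2⟩, by
          obtain ⟨f, g, hg, rfl⟩ := f
          exact hg⟩
      map_add' := fun f g ↦ by
        rw [← S.map_add]
        congr 1
        apply Subtype.ext
        exact T.map_add ⟨f.1, _⟩ ⟨g.1, _⟩
      map_smul' := fun c f ↦ by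
        rw [RingHom.id_apply, ← S.map_smul]
        congr 1
        apply Subtype.ext
        exact T.map_smul c ⟨f.1, _⟩ }

/-- A bounded operator, regarded as a partially defined operator with domain the whole space. -/
def ofBounded (B : H →L[ℂ] H) : H →ₗ.[ℂ] H := (B : H →ₗ[ℂ] H).toPMap ⊤

/-- `R` is the resolvent `(T - z)⁻¹`: a bounded operator which maps into `dom T` and is a two-sided
inverse of `T - z : dom T → H`. -/
def IsResolvent (T : H →ₗ.[ℂ] H) (z : ℂ) (R : H →L[ℂ] H) : Prop :=
  (∀ f : H, ∃ h : R f ∈ T.domain, T ⟨R f, h⟩ - z • R f = f) ∧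
    ∀ f : T.domain, R (T f - z • (f : H)) = f

/-- The resolvent set `ρ(T)`. -/
def resSet (T : H →ₗ.[ℂ] H) : Set ℂ := {z | ∃ R, IsResolvent T z R}

open Classical in
/-- The resolvent `(T - z)⁻¹` for `z ∈ ρ(T)` (and `0` for `z ∉ ρ(T)`). -/
noncomputable def resolventOp (T : H →ₗ.[ℂ] H) (z : ℂ) : H →L[ℂ] H :=
  if h : ∃ R, IsResolvent T z R then h.choose else 0

end Unbounded

/-! ### Operators in `L²(ℝ²)` -/

/-- The plane `ℝ²`; a point is `p = (t, x)` with `t = p 0` and `x = p 1`. -/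
abbrev Plane : Type := EuclideanSpace ℝ (Fin 2)

/-- The complex Hilbert space `L²(ℝ²; dt dx)`. -/
abbrev L2 : Type := Lp ℂ 2 (volume : Measure Plane)

/-- The coordinate unit vector `i` of `ℝ²`. -/
noncomputable def unitVec (i : Fin 2) : Plane := EuclideanSpace.single i 1

open Classical in
/-- The bounded operator of multiplication by `m ∈ L^∞(ℝ²)` (and `0` if `m ∉ L^∞`). -/
noncomputable def mulOp (m : Plane → ℂ) : L2 →L[ℂ] L2 :=
  if h : MemLp m ∞ (volume : Measure Plane) then
    (ContinuousLinearMap.mul ℂ ℂ).holderL volume ∞ 2 2 (h.toLp m)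
  else 0

/-- The Fourier multiplier `𝓕⁻¹ m(ξ) 𝓕` with bounded symbol `m`, where
`(𝓕 f)(ξ) = ∫ exp(-2πi ξ·p) f(p) dp`. -/
noncomputable def fourierMultiplier (m : Plane → ℂ) : L2 →L[ℂ] L2 :=
  ((Lp.fourierTransformₗᵢ Plane ℂ).symm : L2 →L[ℂ] L2) ∘L mulOp m ∘L
    ((Lp.fourierTransformₗᵢ Plane ℂ) : L2 →L[ℂ] L2)

theorem toDist_add (f g : L2) :
    ((f + g : L2) : 𝓢'(Plane, ℂ)) = (f : 𝓢'(Plane, ℂ)) + (g : 𝓢'(Plane, ℂ)) :=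
  map_add (Lp.toTemperedDistributionCLM ℂ volume 2) f g

theorem toDist_smul (c : ℂ) (f : L2) :
    ((c • f : L2) : 𝓢'(Plane, ℂ)) = c • (f : 𝓢'(Plane, ℂ)) :=
  map_smul (Lp.toTemperedDistributionCLM ℂ volume 2) c f

theorem toDist_zero : ((0 : L2) : 𝓢'(Plane, ℂ)) = 0 :=
  map_zero (Lp.toTemperedDistributionCLM ℂ volume 2)

theorem toDist_injective {f g : L2} (h : (f : 𝓢'(Plane, ℂ)) = (g : 𝓢'(Plane, ℂ))) : f = g :=
  LinearMap.ker_eq_bot.1 (Lp.ker_toTemperedDistributionCLM_eq_bot (F := ℂ)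
    (μ := (volume : Measure Plane)) (p := 2)) h

/-- The maximal domain of the weak partial derivative `∂_i` in `L²(ℝ²)`: all `f ∈ L²` whose
distributional derivative `∂_i f` is represented by an element of `L²`. -/
noncomputable def weakDerivDomain (i : Fin 2) : Submodule ℂ L2 where
  carrier := {f | ∃ g : L2, ∂_{unitVec i} (f : 𝓢'(Plane, ℂ)) = (g : 𝓢'(Plane, ℂ))}
  add_mem' := fun {f₁ f₂} ⟨g₁, h₁⟩ ⟨g₂, h₂⟩ ↦
    ⟨g₁ + g₂, by rw [toDist_add, lineDerivOp_add, h₁, h₂, toDist_add]⟩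
  zero_mem' := ⟨0, by rw [toDist_zero, lineDerivOp_zero]⟩
  smul_mem' := fun c f ⟨g, h⟩ ↦
    ⟨c • g, by rw [toDist_smul, lineDerivOp_smul, h, toDist_smul]⟩

/-- The weak partial derivative of an element of the maximal domain, as an element of `L²`. -/
noncomputable def weakDerivFun (i : Fin 2) (f : weakDerivDomain i) : L2 := f.2.choose

theorem weakDerivFun_spec (i : Fin 2) (f : weakDerivDomain i) :
    ∂_{unitVec i} ((f : L2) : 𝓢'(Plane, ℂ)) = (weakDerivFun i f : 𝓢'(Plane, ℂ)) :=
  f.2.choose_spec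

/-- The weak partial derivative `∂_i` in `L²(ℝ²)`, as an operator on its maximal domain. -/
noncomputable def weakDeriv (i : Fin 2) : L2 →ₗ.[ℂ] L2 where
  domain := weakDerivDomain i
  toFun :=
    { toFun := weakDerivFun i
      map_add' := fun f₁ f₂ ↦ toDist_injective <| by
        rw [toDist_add, ← weakDerivFun_spec, ← weakDerivFun_spec, ← weakDerivFun_spec,
          Submodule.coe_add, toDist_add, lineDerivOp_add]
      map_smul' := fun c f ↦ toDist_injective <| by
        rw [RingHom.id_apply, toDist_smul, ← weakDerivFun_spec, ← weakDerivFun_spec,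
          Submodule.coe_smul, toDist_smul, lineDerivOp_smul] }

/-- The Sobolev space `W^{2,2}(ℝ²)`: all `f ∈ L²` whose distributional derivatives of orders one
and two are represented by elements of `L²`. -/
noncomputable def W22 : Submodule ℂ L2 where
  carrier := {f | (∀ i : Fin 2, ∃ g : L2, ∂_{unitVec i} (f : 𝓢'(Plane, ℂ)) = (g : 𝓢'(Plane, ℂ))) ∧
    ∀ i j : Fin 2, ∃ g : L2, ∂_{unitVec i} (∂_{unitVec j} (f : 𝓢'(Plane, ℂ))) = (g : 𝓢'(Plane, ℂ))}
  add_mem' := fun {f₁ f₂} h₁ h₂ ↦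
    ⟨fun i ↦ by
      obtain ⟨g₁, k₁⟩ := h₁.1 i
      obtain ⟨g₂, k₂⟩ := h₂.1 i
      exact ⟨g₁ + g₂, by rw [toDist_add, lineDerivOp_add, k₁, k₂, toDist_add]⟩,
    fun i j ↦ by
      obtain ⟨g₁, k₁⟩ := h₁.2 i j
      obtain ⟨g₂, k₂⟩ := h₂.2 i j
      exact ⟨g₁ + g₂, by
        rw [toDist_add, lineDerivOp_add, lineDerivOp_add, k₁, k₂, toDist_add]⟩⟩
  zero_mem' :=
    ⟨fun i ↦ ⟨0, by rw [toDist_zero, lineDerivOp_zero]⟩,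
      fun i j ↦ ⟨0, by rw [toDist_zero, lineDerivOp_zero, lineDerivOp_zero]⟩⟩
  smul_mem' := fun c f h ↦
    ⟨fun i ↦ by
      obtain ⟨g, k⟩ := h.1 i
      exact ⟨c • g, by rw [toDist_smul, lineDerivOp_smul, k, toDist_smul]⟩,
    fun i j ↦ by
      obtain ⟨g, k⟩ := h.2 i j
      exact ⟨c • g, by rw [toDist_smul, lineDerivOp_smul, lineDerivOp_smul, k, toDist_smul]⟩⟩

/-! ### The model -/

/-- The standing hypothesis on the real-valued functions `φ` and `θ`. The derivative of a locally
absolutely continuous function exists almost everywhere, and there it is `deriv`. -/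
structure Hyp (φ θ : ℝ → ℝ) : Prop where
  phi_ac : ∀ a b : ℝ, AbsolutelyContinuousOnInterval φ a b
  phi_bdd : MemLp φ ∞ volume
  phi_int : MemLp φ 1 volume
  phi'_bdd : MemLp (deriv φ) ∞ volume
  theta_ac : ∀ a b : ℝ, AbsolutelyContinuousOnInterval θ a b
  theta_bdd : MemLp θ ∞ volume
  theta'_bdd : MemLp (deriv θ) ∞ volume
  theta'_int : MemLp (deriv θ) 1 volume
  theta_top : Tendsto θ atTop (𝓝 1)
  theta_bot : Tendsto θ atBot (𝓝 0)

/-- `d/dt` in `L²(ℝ²)`. -/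
noncomputable def ddt : L2 →ₗ.[ℂ] L2 := weakDeriv 0

/-- `A_- = -i d/dx` in `L²(ℝ²)`, acting fibrewise in `x`. -/
noncomputable def opA : L2 →ₗ.[ℂ] L2 := (-Complex.I) • weakDeriv 1

/-- `B`, the operator of multiplication by `θ(t) φ(x)`. -/
noncomputable def opB (φ θ : ℝ → ℝ) : L2 →L[ℂ] L2 :=
  mulOp fun p ↦ ((θ (p 0) * φ (p 1) : ℝ) : ℂ)

/-- `B'`, the operator of multiplication by `θ'(t) φ(x)`. -/
noncomputable def opB' (φ θ : ℝ → ℝ) : L2 →L[ℂ] L2 :=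
  mulOp fun p ↦ ((deriv θ (p 0) * φ (p 1) : ℝ) : ℂ)

/-- `D_A = d/dt + A` with `A = A_- + B`. The domain of the sum is the intersection
`dom (d/dt) ∩ dom A_-`, which is `W^{1,2}(ℝ²)`. -/
noncomputable def opD (φ θ : ℝ → ℝ) : L2 →ₗ.[ℂ] L2 := ddt + (opA + ofBounded (opB φ θ))

/-- `H₁ = D_A^* D_A` and `H₂ = D_A D_A^*` (`opH φ θ j` for `j = 1, 2`). -/
noncomputable def opH (φ θ : ℝ → ℝ) (j : ℕ) : L2 →ₗ.[ℂ] L2 :=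
  if j = 1 then opComp (opD φ θ).adjoint (opD φ θ) else opComp (opD φ θ) (opD φ θ).adjoint

/-- `H₀ = -d²/dt² + A_-² = -Δ` with domain `W^{2,2}(ℝ²)`. -/
noncomputable def opH0 : L2 →ₗ.[ℂ] L2 := (-opComp ddt ddt + opComp opA opA).domRestrict W22

/-- `χ_n(ν) = n / (ν² + n²)^{1/2}`. -/
noncomputable def chi (n : ℕ) (ν : ℝ) : ℝ := n / Real.sqrt (ν ^ 2 + n ^ 2)

/-- `χ_n(A_-)`. The Fourier transform `𝓕` turns `A_-` into multiplication by `2π ξ₁`, where `ξ₁` is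
the variable dual to `x`, so it turns `χ_n(A_-)` into multiplication by `χ_n(2π ξ₁)`. -/
noncomputable def chiA (n : ℕ) : L2 →L[ℂ] L2 :=
  fourierMultiplier fun ξ ↦ (chi n (2 * Real.pi * ξ 1) : ℂ)

/-- `B_n = χ_n(A_-) B χ_n(A_-)`. -/
noncomputable def opBn (φ θ : ℝ → ℝ) (n : ℕ) : L2 →L[ℂ] L2 := chiA n ∘L opB φ θ ∘L chiA n

/-- `B_n' = χ_n(A_-) B' χ_n(A_-)`. -/
noncomputable def opBn' (φ θ : ℝ → ℝ) (n : ℕ) : L2 →L[ℂ] L2 := chiA n ∘L opB' φ θ ∘L chiA n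

/-- `H_{j,n} = H₀ + B_n A_- + A_- B_n + B_n² + (-1)^j B_n'` with domain `dom H₀ = W^{2,2}(ℝ²)`. -/
noncomputable def opHn (φ θ : ℝ → ℝ) (j n : ℕ) : L2 →ₗ.[ℂ] L2 :=
  opH0 + opComp (ofBounded (opBn φ θ n)) opA + opComp opA (ofBounded (opBn φ θ n)) +
    ofBounded (opBn φ θ n ∘L opBn φ θ n) + ofBounded ((-1 : ℂ) ^ j • opBn' φ θ n)

end DiracSchrodinger

open DiracSchrodinger

/-!
The proof replaces all unbounded operators by bounded ones. Let `J = (1 - Δ/4π²)^(-1/2)` and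
`Gᵢ = ∂ᵢ J`; both are Fourier multipliers with bounded symbols, and `J` maps `L²` bijectively onto
`W^{1,2}`. With `G = (∓ d/dt + A₋) J` the operators `D` and `D*` become `G + B J` and `G* + B J`
on the range of `J` (`HasGraph`, `hasGraph_opD`, `IsModel.hasGraph_adjoint`), and the resolvent of
the product is `J M⁻¹ J`, where `M = J (D* D - z) J = (G + B J)* (G + B J) - z J²` is bounded.
Since `G* G = 4π² (1 - J²)`, the form of `M` is coercive for `z ∉ [0, ∞)`, with a constant that
depends on `B` only through a bound for `‖B‖` (`IsModel.exists_coercive`), so that `M` is invertible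
by the Lax-Milgram lemma.

The product rule `∂ᵢ B = B ∂ᵢ + (∂ᵢ B)` for the Lipschitz potential `θ(t) φ(x)`
(`opG_realMul_opJ`) gives `M = 4π² - J L` with a bounded operator `L`. Hence
`(H_j - z)⁻¹ = J² K` with `K` bounded (`IsModel.modelRes_eq`). The operator `χ_n(A₋)` commutes with
`J` and `Gᵢ`, so `B_n` satisfies the same product rule with the smoothed derivatives, and the same
description applies to `H_{j,n}`; the product rule also identifies `H_{j,n}`, which is given as a
sum with domain `W^{2,2}`, with the operator constructed in this way (`hasGraph_opHn`,
`opJ_mul_schrodingerJ`). As `χ_n(A₋) → 1` strongly, the operators `K_n` that belong to `B_n`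
converge strongly to `K`, together with their adjoints (`IsModel.strongStarTendsto_regOp`).

In two dimensions the symbol of `J²` is square integrable, so `f J²` is Hilbert-Schmidt for every
multiplication operator `f` with `f ∈ L² ∩ L^∞` (`hsSq_mulOp_opJ_ne_top`). Writing
`B_n' (H_{j,n} - z)⁻¹ = χ_n (B' J²) χ_n K_n`, the limit in the Hilbert-Schmidt norm follows because a
Hilbert-Schmidt operator turns strong convergence of bounded factors on the left, and of their
adjoints on the right, into convergence in norm. For the trace norm `2 B'` is factorized as `g f`
with `|f|²` and `|g|²` multiples of `|B'|`, which is bounded and integrable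
(`exists_factorization`). Then the operator in question is a product of two Hilbert-Schmidt
operators, each of which converges in the Hilbert-Schmidt norm.

The trace ideals are defined by approximation numbers. Neither the spectral theorem nor sharp
constants are needed: a basis-dependent Hilbert-Schmidt norm controls `𝓑₂` up to a factor
(`schattenNorm_two_le`), and Hölder's inequality `𝓑₂ 𝓑₂ ⊆ 𝓑₁` holds up to a factor
(`schattenNorm_one_comp_le`).
-/

namespace DiracSchrodinger

/-! ### Singular values of sums and products -/

section SingularValues

variable {H : Type*} [NormedAddCommGroup H] [InnerProductSpace ℂ H]

theorem singularValue_le {T F : H →L[ℂ] H} {n : ℕ}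
    (hF : LinearMap.rank (F : H →ₗ[ℂ] H) ≤ n) : singularValue T n ≤ ‖T - F‖ₑ :=
  iInf_le (fun F : {F : H →L[ℂ] H // LinearMap.rank (F : H →ₗ[ℂ] H) ≤ n} ↦ ‖T - F.1‖ₑ) ⟨F, hF⟩

theorem singularValue_antitone (T : H →L[ℂ] H) : Antitone (singularValue T) := by
  intro m n hmn
  refine le_iInf fun F ↦ singularValue_le (F.2.trans ?_)
  exact_mod_cast hmn

theorem exists_enorm_sub_ne_top (T : H →L[ℂ] H) (n : ℕ) :
    ∃ F : {F : H →L[ℂ] H // LinearMap.rank (F : H →ₗ[ℂ] H) ≤ n}, ‖T - F.1‖ₑ ≠ ∞ :=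
  ⟨⟨0, by simp⟩, by simp⟩

theorem singularValue_add_le (S T : H →L[ℂ] H) (m n : ℕ) :
    singularValue (S + T) (m + n) ≤ singularValue S m + singularValue T n := by
  refine ENNReal.le_iInf_add_iInf fun F F' ↦ ?_
  have hr : LinearMap.rank ((F.1 + F'.1 : H →L[ℂ] H) : H →ₗ[ℂ] H) ≤ (m + n : ℕ) := by
    rw [ContinuousLinearMap.toLinearMap_add, Nat.cast_add]
    exact (LinearMap.rank_add_le _ _).trans (add_le_add F.2 F'.2)
  refine (singularValue_le hr).trans ?_
  rw [add_sub_add_comm]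
  exact enorm_add_le (S - F.1) (T - F'.1)

theorem singularValue_comp_le (S T : H →L[ℂ] H) (m n : ℕ) :
    singularValue (S ∘L T) (m + n) ≤ singularValue S m * singularValue T n := by
  refine ENNReal.le_iInf_mul_iInf (exists_enorm_sub_ne_top S m) (exists_enorm_sub_ne_top T n)
    fun F F' ↦ ?_
  have hr : LinearMap.rank ((F.1 ∘L T + (S - F.1) ∘L F'.1 : H →L[ℂ] H) : H →ₗ[ℂ] H)
      ≤ (m + n : ℕ) := by
    rw [ContinuousLinearMap.toLinearMap_add, Nat.cast_add]
    refine (LinearMap.rank_add_le _ _).trans (add_le_add ?_ ?_)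
    · exact (LinearMap.rank_comp_le_left _ _).trans F.2
    · have h : ((S - F.1) ∘L F'.1 : H →L[ℂ] H).toLinearMap
          = ((S - F.1 : H →L[ℂ] H) : H →ₗ[ℂ] H) ∘ₗ (F'.1 : H →ₗ[ℂ] H) := rfl
      rw [h]
      exact (LinearMap.rank_comp_le_right _ _).trans F'.2
  refine (singularValue_le hr).trans ?_
  -- `(S - F) (T - F')` differs from `S T` by an operator of rank at most `m + n`
  have h : S ∘L T - (F.1 ∘L T + (S - F.1) ∘L F'.1) = (S - F.1) ∘L (T - F'.1) := by
    ext x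
    simp only [sub_apply, add_apply,
      ContinuousLinearMap.comp_apply, map_sub]
    abel
  rw [h, ← ofReal_norm, ← ofReal_norm, ← ofReal_norm, ← ENNReal.ofReal_mul (norm_nonneg _)]
  exact ENNReal.ofReal_le_ofReal (ContinuousLinearMap.opNorm_comp_le _ _)

theorem tsum_le_two_mul_tsum_even {f : ℕ → ℝ≥0∞} (hf : Antitone f) :
    ∑' n, f n ≤ 2 * ∑' n, f (n + n) := by
  rw [← tsum_even_add_odd ENNReal.summable ENNReal.summable, two_mul]
  refine add_le_add (ENNReal.tsum_le_tsum fun n ↦ ?_) (ENNReal.tsum_le_tsum fun n ↦ ?_)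
  · rw [two_mul]
  · exact hf (by omega)

theorem schattenNorm_one (T : H →L[ℂ] H) : schattenNorm 1 T = ∑' n, singularValue T n := by
  simp [schattenNorm]

theorem schattenNorm_one_add_le (S T : H →L[ℂ] H) :
    schattenNorm 1 (S + T) ≤ 2 * (schattenNorm 1 S + schattenNorm 1 T) := by
  simp only [schattenNorm_one]
  refine (tsum_le_two_mul_tsum_even (singularValue_antitone _)).trans ?_
  rw [← ENNReal.tsum_add]
  gcongr with n
  exact singularValue_add_le S T n n

theorem tsum_mul_le_rpow_tsum (f g : ℕ → ℝ≥0∞) :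
    ∑' n, f n * g n ≤ (∑' n, f n ^ (2 : ℝ)) ^ (1 / 2 : ℝ) * (∑' n, g n ^ (2 : ℝ)) ^ (1 / 2 : ℝ) := by
  rw [ENNReal.tsum_eq_iSup_sum]
  refine iSup_le fun s ↦ (ENNReal.inner_le_Lp_mul_Lq s f g Real.HolderConjugate.two_two).trans ?_
  gcongr <;> exact ENNReal.sum_le_tsum s

/-- Hölder's inequality for the trace ideals, up to the constant `2`: half of the singular values
are enough, since they decrease, and `s_{2n}(S T) ≤ s_n(S) s_n(T)`. -/
theorem schattenNorm_one_comp_le (S T : H →L[ℂ] H) :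
    schattenNorm 1 (S ∘L T) ≤ 2 * (schattenNorm 2 S * schattenNorm 2 T) := by
  rw [schattenNorm_one]
  refine (tsum_le_two_mul_tsum_even (singularValue_antitone _)).trans ?_
  gcongr
  refine (ENNReal.tsum_le_tsum fun n ↦ singularValue_comp_le S T n n).trans ?_
  exact tsum_mul_le_rpow_tsum _ _

end SingularValues

/-! ### The Hilbert-Schmidt norm -/

section HilbertSchmidt

variable {H : Type*} [NormedAddCommGroup H] [InnerProductSpace ℂ H]

theorem tsum_enorm_inner_sq_le {κ : Type*} {v : κ → H} (hv : Orthonormal ℂ v) (x : H) :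
    ∑' k, ‖inner ℂ (v k) x‖ₑ ^ 2 ≤ ‖x‖ₑ ^ 2 := by
  rw [ENNReal.tsum_eq_iSup_sum]
  refine iSup_le fun s ↦ ?_
  simp only [← ofReal_norm, ← ENNReal.ofReal_pow (norm_nonneg _)]
  rw [← ENNReal.ofReal_sum_of_nonneg fun _ _ ↦ by positivity]
  exact ENNReal.ofReal_le_ofReal (hv.sum_inner_products_le x)

theorem tsum_enorm_inner_sq {ι : Type*} (b : HilbertBasis ι ℂ H) (x : H) :
    ∑' i, ‖inner ℂ (b i) x‖ₑ ^ 2 = ‖x‖ₑ ^ 2 := by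
  have h := (b.hasSum_inner_mul_inner x x).mapL Complex.reCLM
  have h' : HasSum (fun i ↦ ‖inner ℂ (b i) x‖ ^ 2) (‖x‖ ^ 2) := by
    convert h using 2 with i
    · rw [← inner_conj_symm x, mul_comm, Complex.mul_conj, Complex.reCLM_apply, Complex.ofReal_re,
        Complex.normSq_eq_norm_sq]
    · rw [inner_self_eq_norm_sq_to_K, Complex.reCLM_apply]
      norm_cast
  simp only [← ofReal_norm, ← ENNReal.ofReal_pow (norm_nonneg _)]
  rw [← h'.tsum_eq, ENNReal.ofReal_tsum_of_nonneg (fun _ ↦ by positivity) h'.summable]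

/-- The square of the Hilbert-Schmidt norm of `T`, computed in the Hilbert basis `b`. -/
noncomputable def hsSq {ι : Type*} (b : HilbertBasis ι ℂ H) (T : H →L[ℂ] H) : ℝ≥0∞ :=
  ∑' i, ‖T (b i)‖ₑ ^ 2

variable {ι : Type*} (b : HilbertBasis ι ℂ H)

theorem hsSq_add_le (S T : H →L[ℂ] H) : hsSq b (S + T) ≤ 2 * (hsSq b S + hsSq b T) := by
  rw [hsSq, hsSq, hsSq, ← ENNReal.tsum_add, ← ENNReal.tsum_mul_left]
  refine ENNReal.tsum_le_tsum fun i ↦ ?_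
  have h : ‖(S + T) (b i)‖ ^ 2 ≤ 2 * (‖S (b i)‖ ^ 2 + ‖T (b i)‖ ^ 2) := by
    have := norm_add_le (S (b i)) (T (b i))
    rw [add_apply]
    nlinarith [sq_nonneg (‖S (b i)‖ - ‖T (b i)‖), norm_nonneg (S (b i) + T (b i))]
  have h2 := ENNReal.ofReal_le_ofReal h
  rwa [ENNReal.ofReal_mul (by norm_num), ENNReal.ofReal_add (by positivity) (by positivity),
    ENNReal.ofReal_pow (norm_nonneg _), ENNReal.ofReal_pow (norm_nonneg _),
    ENNReal.ofReal_pow (norm_nonneg _), ofReal_norm, ofReal_norm, ofReal_norm,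
    ENNReal.ofReal_ofNat] at h2

theorem hsSq_comp_le (S T : H →L[ℂ] H) : hsSq b (S ∘L T) ≤ ‖S‖ₑ ^ 2 * hsSq b T := by
  rw [hsSq, hsSq, ← ENNReal.tsum_mul_left]
  refine ENNReal.tsum_le_tsum fun i ↦ ?_
  rw [← mul_pow]
  gcongr
  exact S.le_opENorm _

/-- Dominated convergence: `S_n T → 0` in the Hilbert-Schmidt norm if `T` is Hilbert-Schmidt and
`S_n → 0` strongly. -/
theorem tendsto_hsSq_comp {S : ℕ → H →L[ℂ] H} {T : H →L[ℂ] H} (hT : hsSq b T ≠ ∞) {C : ℝ}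
    (hC : ∀ n, ‖S n‖ ≤ C) (hS : ∀ x, Tendsto (fun n ↦ S n x) atTop (𝓝 0)) :
    Tendsto (fun n ↦ hsSq b (S n ∘L T)) atTop (𝓝 0) := by
  have hsum : Summable fun i ↦ ‖T (b i)‖ ^ 2 := by
    have := ENNReal.summable_toReal hT
    simpa [ENNReal.toReal_pow] using this
  have hle : ∀ n i, ‖(S n ∘L T) (b i)‖ ^ 2 ≤ C ^ 2 * ‖T (b i)‖ ^ 2 := fun n i ↦ by
    rw [← mul_pow]
    gcongr
    exact (S n).le_of_opNorm_le (hC n) _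
  have key : Tendsto (fun n ↦ ∑' i, ‖(S n ∘L T) (b i)‖ ^ 2) atTop (𝓝 (∑' _ : ι, (0 : ℝ))) := by
    refine tendsto_tsum_of_dominated_convergence (bound := fun i ↦ C ^ 2 * ‖T (b i)‖ ^ 2)
      (hsum.mul_left _) (fun i ↦ ?_) (.of_forall fun n i ↦ ?_)
    · have := (hS (T (b i))).norm.pow 2
      simpa using this
    · rw [Real.norm_of_nonneg (by positivity)]
      exact hle n i
  rw [tsum_zero] at key
  have h2 := ENNReal.tendsto_ofReal key
  rw [ENNReal.ofReal_zero] at h2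
  refine h2.congr fun n ↦ ?_
  rw [ENNReal.ofReal_tsum_of_nonneg (fun _ ↦ by positivity)
    (Summable.of_nonneg_of_le (fun _ ↦ by positivity) (hle n) (hsum.mul_left _)), hsSq]
  simp only [ENNReal.ofReal_pow (norm_nonneg _), ofReal_norm]

variable [CompleteSpace H]

theorem tsum_enorm_sq_le_hsSq_adjoint {κ : Type*} {v : κ → H} (hv : Orthonormal ℂ v)
    (T : H →L[ℂ] H) :
    ∑' k, ‖T (v k)‖ₑ ^ 2 ≤ hsSq b (ContinuousLinearMap.adjoint T) := by
  calc ∑' k, ‖T (v k)‖ₑ ^ 2 = ∑' k, ∑' i, ‖inner ℂ (b i) (T (v k))‖ₑ ^ 2 := by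
        simp only [tsum_enorm_inner_sq]
    _ = ∑' i, ∑' k, ‖inner ℂ (v k) (ContinuousLinearMap.adjoint T (b i))‖ₑ ^ 2 := by
        rw [ENNReal.tsum_comm]
        congr! 5 with i k
        rw [ContinuousLinearMap.adjoint_inner_right, ← inner_conj_symm, RCLike.enorm_conj]
    _ ≤ _ := ENNReal.tsum_le_tsum fun i ↦ tsum_enorm_inner_sq_le hv _

theorem hsSq_adjoint (T : H →L[ℂ] H) : hsSq b (ContinuousLinearMap.adjoint T) = hsSq b T := by
  refine le_antisymm ?_ (tsum_enorm_sq_le_hsSq_adjoint b b.orthonormal T)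
  have := tsum_enorm_sq_le_hsSq_adjoint b b.orthonormal (ContinuousLinearMap.adjoint T)
  rwa [ContinuousLinearMap.adjoint_adjoint] at this

theorem hsSq_comp_le' (S T : H →L[ℂ] H) : hsSq b (S ∘L T) ≤ ‖T‖ₑ ^ 2 * hsSq b S := by
  rw [← hsSq_adjoint, ContinuousLinearMap.adjoint_comp]
  refine (hsSq_comp_le b _ _).trans ?_
  rw [hsSq_adjoint, ← ofReal_norm, LinearIsometryEquiv.norm_map, ofReal_norm]

open Classical in
/-- One step of the construction in `exists_orthogonal_seq`: orthogonally to `k` given vectors, a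
unit vector can be found on which `T` is at least half as large as its `k`-th singular value. -/
theorem exists_unit_orthogonal (T : H →L[ℂ] H) (k : ℕ) (g : ℕ → H) :
    ∃ y : H, (y = 0 ∨ ‖y‖ = 1) ∧ singularValue T k ≤ 2 * ‖T y‖ₑ ∧ ∀ i < k, inner ℂ (g i) y = 0 := by
  by_cases hs : singularValue T k = 0
  · exact ⟨0, .inl rfl, by simp [hs], by simp⟩
  set K : Submodule ℂ H := Submodule.span ℂ ((Finset.range k).image g : Set H) with hK
  have : FiniteDimensional ℂ K := FiniteDimensional.span_finset ℂ _
  set P : H →L[ℂ] H := K.starProjection with hP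
  have hrank : LinearMap.rank ((T ∘L P : H →L[ℂ] H) : H →ₗ[ℂ] H) ≤ k := by
    have h : ((T ∘L P : H →L[ℂ] H) : H →ₗ[ℂ] H) = (T : H →ₗ[ℂ] H) ∘ₗ (P : H →ₗ[ℂ] H) := rfl
    rw [h]
    refine (LinearMap.rank_comp_le_right _ _).trans ?_
    have hr : LinearMap.range (P : H →ₗ[ℂ] H) ≤ K := by
      rintro _ ⟨x, rfl⟩
      exact K.starProjection_apply_mem x
    refine (Submodule.rank_mono hr).trans ((rank_span_finset_le _).trans ?_)
    exact_mod_cast Finset.card_image_le.trans_eq (Finset.card_range k)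
  have hsle := singularValue_le (T := T) hrank
  set Q : H →L[ℂ] H := T - T ∘L P with hQ
  have hQpos : 0 < ‖Q‖ := by
    by_contra h
    have : Q = 0 := by simpa using h
    simp [this] at hsle
    exact hs hsle
  obtain ⟨x, hx⟩ : ∃ x, ‖Q‖ / 2 * ‖x‖ < ‖Q x‖ := by
    by_contra! h
    have := Q.opNorm_le_bound (by positivity) h
    linarith
  set y := x - P x with hy
  have hQx : Q x = T y := by simp [hQ, hy]
  have hyx : ‖y‖ ≤ ‖x‖ := by
    have h := K.norm_sq_eq_add_norm_sq_starProjection x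
    have h' : Kᗮ.starProjection x = y := by
      rw [Submodule.starProjection_orthogonal_val]
    rw [h'] at h
    exact le_of_sq_le_sq (by nlinarith [sq_nonneg ‖K.starProjection x‖]) (norm_nonneg _)
  have hy0 : 0 < ‖y‖ := by
    rw [norm_pos_iff]
    intro h0
    rw [hQx, h0, map_zero, norm_zero] at hx
    have : 0 ≤ ‖Q‖ / 2 * ‖x‖ := by positivity
    linarith
  refine ⟨((‖y‖⁻¹ : ℝ) : ℂ) • y, .inr ?_, hsle.trans ?_, fun i hi ↦ ?_⟩
  · rw [norm_smul, Complex.norm_real, norm_inv, norm_norm, inv_mul_cancel₀ hy0.ne']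
  · have h : ‖Q‖ ≤ 2 * ‖T (((‖y‖⁻¹ : ℝ) : ℂ) • y)‖ := by
      rw [map_smul, norm_smul, Complex.norm_real, norm_inv, norm_norm, ← hQx]
      have h1 : ‖Q‖ / 2 * ‖y‖ ≤ ‖Q x‖ := (by gcongr : _ ≤ ‖Q‖ / 2 * ‖x‖).trans hx.le
      rw [← div_eq_inv_mul, ← mul_div_assoc, le_div_iff₀ hy0]
      linarith
    have h2 := ENNReal.ofReal_le_ofReal h
    rwa [ENNReal.ofReal_mul (by norm_num), ofReal_norm, ofReal_norm, ENNReal.ofReal_ofNat] at h2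
  · have hg : g i ∈ K := Submodule.subset_span (by simpa using ⟨i, hi, rfl⟩)
    have h := (K.sub_starProjection_mem_orthogonal x) (g i) hg
    rw [inner_smul_right, h, mul_zero]

theorem exists_orthogonal_seq (T : H →L[ℂ] H) :
    ∃ f : ℕ → H, (∀ k, f k = 0 ∨ ‖f k‖ = 1) ∧ (∀ k, singularValue T k ≤ 2 * ‖T (f k)‖ₑ) ∧
      ∀ i k, i < k → inner ℂ (f i) (f k) = 0 := by
  choose Y h1 h2 h3 using exists_unit_orthogonal T
  let F : ℕ → ℕ → H := fun k ↦ Nat.rec 0 (fun k g ↦ Function.update g k (Y k g)) k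
  have hF : ∀ k, F (k + 1) = Function.update (F k) k (Y k (F k)) := fun k ↦ rfl
  have hstab : ∀ i k, i < k → F k i = Y i (F i) := by
    intro i k hik
    induction k with
    | zero => omega
    | succ k ih =>
      rw [hF]
      rcases eq_or_ne i k with rfl | hne
      · simp
      · rw [Function.update_of_ne hne, ih (by omega)]
  refine ⟨fun k ↦ Y k (F k), fun k ↦ h1 _ _, fun k ↦ h2 _ _, fun i k hik ↦ ?_⟩
  have := h3 k (F k) i hik
  rwa [hstab i k hik] at this

/-- A Hilbert-Schmidt operator is in `𝓑₂`. No spectral theorem is needed: by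
`exists_orthogonal_seq` the singular values are dominated by the norms of the images of
orthonormal vectors, to which Bessel's inequality applies. -/
theorem schattenNorm_two_le (T : H →L[ℂ] H) :
    schattenNorm 2 T ≤ (4 * hsSq b T) ^ (1 / 2 : ℝ) := by
  obtain ⟨f, h1, h2, h3⟩ := exists_orthogonal_seq T
  rw [schattenNorm]
  gcongr
  have hv : Orthonormal ℂ fun k : {k // f k ≠ 0} ↦ f k := by
    refine ⟨fun k ↦ (h1 k).resolve_left k.2, fun i k hik ↦ ?_⟩
    rcases lt_or_gt_of_ne (Subtype.coe_ne_coe.2 hik) with h | h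
    · exact h3 _ _ h
    · rw [← inner_conj_symm, h3 _ _ h, map_zero]
  calc ∑' n, singularValue T n ^ (2 : ℝ) ≤ ∑' n, 4 * ‖T (f n)‖ₑ ^ 2 := by
        refine ENNReal.tsum_le_tsum fun n ↦ ?_
        rw [ENNReal.rpow_two]
        calc _ ≤ (2 * ‖T (f n)‖ₑ) ^ 2 := by gcongr; exact h2 n
          _ = _ := by rw [mul_pow]; norm_num
    _ = 4 * ∑' n, ‖T (f n)‖ₑ ^ 2 := ENNReal.tsum_mul_left
    _ = 4 * ∑' k : {k // f k ≠ 0}, ‖T (f k)‖ₑ ^ 2 := by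
        congr 1
        refine (tsum_subtype_eq_of_support_subset (s := {k | f k ≠ 0}) fun n hn ↦ ?_).symm
        intro h0
        simp [h0] at hn
    _ ≤ 4 * hsSq b T := by
        gcongr
        rw [← hsSq_adjoint]
        exact tsum_enorm_sq_le_hsSq_adjoint b hv T

end HilbertSchmidt

/-! ### Strong convergence together with the adjoints -/

section StrongStar

variable {H : Type*} [NormedAddCommGroup H] [InnerProductSpace ℂ H] [CompleteSpace H]

/-- A bounded sequence of operators which converges strongly, and whose adjoints converge strongly
to the adjoint of the limit. Unlike strong convergence alone, this is stable under products and
adjoints. -/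
structure StrongStarTendsto (T : ℕ → H →L[ℂ] H) (S : H →L[ℂ] H) : Prop where
  bdd : ∃ C : ℝ, ∀ n, ‖T n‖ ≤ C
  tendsto : ∀ x, Tendsto (fun n ↦ T n x) atTop (𝓝 (S x))
  tendsto_star : ∀ x, Tendsto (fun n ↦ star (T n) x) atTop (𝓝 (star S x))

omit [CompleteSpace H] in
/-- Strong convergence of a bounded sequence, applied to a convergent sequence of vectors. -/
theorem tendsto_apply_of_bdd {T : ℕ → H →L[ℂ] H} {S : H →L[ℂ] H} {C : ℝ} (hC : ∀ n, ‖T n‖ ≤ C)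
    (hT : ∀ x, Tendsto (fun n ↦ T n x) atTop (𝓝 (S x))) {u : ℕ → H} {v : H}
    (hu : Tendsto u atTop (𝓝 v)) : Tendsto (fun n ↦ T n (u n)) atTop (𝓝 (S v)) := by
  have h1 : Tendsto (fun n ↦ T n (u n - v)) atTop (𝓝 0) := by
    refine squeeze_zero_norm (a := fun n ↦ C * ‖u n - v‖)
      (fun n ↦ (T n).le_of_opNorm_le (hC n) _) ?_
    have := (tendsto_iff_norm_sub_tendsto_zero.1 hu).const_mul C
    simpa using this
  have h2 := h1.add (hT v)
  rw [zero_add] at h2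
  refine h2.congr fun n ↦ ?_
  rw [map_sub]
  abel

namespace StrongStarTendsto

variable {T T' : ℕ → H →L[ℂ] H} {S S' : H →L[ℂ] H}

theorem const (S : H →L[ℂ] H) : StrongStarTendsto (fun _ ↦ S) S :=
  ⟨⟨‖S‖, fun _ ↦ le_rfl⟩, fun _ ↦ tendsto_const_nhds, fun _ ↦ tendsto_const_nhds⟩

theorem star (h : StrongStarTendsto T S) :
    StrongStarTendsto (fun n ↦ Star.star (T n)) (Star.star S) := by
  obtain ⟨C, hC⟩ := h.bdd
  exact ⟨⟨C, fun n ↦ (norm_star _).trans_le (hC n)⟩, h.tendsto_star, by simpa using h.tendsto⟩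

theorem add (h : StrongStarTendsto T S) (h' : StrongStarTendsto T' S') :
    StrongStarTendsto (fun n ↦ T n + T' n) (S + S') := by
  obtain ⟨C, hC⟩ := h.bdd
  obtain ⟨C', hC'⟩ := h'.bdd
  refine ⟨⟨C + C', fun n ↦ (norm_add_le _ _).trans (add_le_add (hC n) (hC' n))⟩, fun x ↦ ?_,
    fun x ↦ ?_⟩
  · simpa using (h.tendsto x).add (h'.tendsto x)
  · simpa using (h.tendsto_star x).add (h'.tendsto_star x)

theorem smul (c : ℂ) (h : StrongStarTendsto T S) :
    StrongStarTendsto (fun n ↦ c • T n) (c • S) := by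
  obtain ⟨C, hC⟩ := h.bdd
  refine ⟨⟨‖c‖ * C, fun n ↦ ?_⟩, fun x ↦ ?_, fun x ↦ ?_⟩
  · rw [norm_smul]
    gcongr
    exact hC n
  · simpa using (h.tendsto x).const_smul c
  · simpa using (h.tendsto_star x).const_smul (Star.star c)

theorem sub (h : StrongStarTendsto T S) (h' : StrongStarTendsto T' S') :
    StrongStarTendsto (fun n ↦ T n - T' n) (S - S') := by
  simpa [sub_eq_add_neg] using h.add (h'.smul (-1))

theorem mul (h : StrongStarTendsto T S) (h' : StrongStarTendsto T' S') :
    StrongStarTendsto (fun n ↦ T n * T' n) (S * S') := by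
  obtain ⟨C, hC⟩ := h.bdd
  obtain ⟨C', hC'⟩ := h'.bdd
  refine ⟨⟨C * C', fun n ↦ (norm_mul_le _ _).trans ?_⟩, fun x ↦ ?_, fun x ↦ ?_⟩
  · exact mul_le_mul (hC n) (hC' n) (norm_nonneg _) ((norm_nonneg _).trans (hC 0))
  · exact tendsto_apply_of_bdd hC h.tendsto (h'.tendsto x)
  · simp only [star_mul]
    exact tendsto_apply_of_bdd (C := C') (fun n ↦ (norm_star _).trans_le (hC' n)) h'.tendsto_star
      (h.tendsto_star x)

omit [CompleteSpace H] in
theorem tendsto_inv {T R : ℕ → H →L[ℂ] H} {S Q : H →L[ℂ] H}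
    (h : ∀ x, Tendsto (fun n ↦ T n x) atTop (𝓝 (S x))) {C : ℝ} (hC : ∀ n, ‖R n‖ ≤ C)
    (hR : ∀ n, R n * T n = 1) (hQ : S * Q = 1) (x : H) :
    Tendsto (fun n ↦ R n x) atTop (𝓝 (Q x)) := by
  -- `R_n - Q = R_n (S - T_n) Q`
  have h1 : Tendsto (fun n ↦ R n (S (Q x) - T n (Q x))) atTop (𝓝 0) := by
    refine squeeze_zero_norm (a := fun n ↦ C * ‖S (Q x) - T n (Q x)‖)
      (fun n ↦ (R n).le_of_opNorm_le (hC n) _) ?_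
    have := ((tendsto_const_nhds (x := S (Q x))).sub (h (Q x))).norm.const_mul C
    simpa using this
  have h2 := h1.add_const (Q x)
  rw [zero_add] at h2
  refine h2.congr fun n ↦ ?_
  have e1 : R n (T n (Q x)) = Q x := DFunLike.congr_fun (hR n) (Q x)
  have e2 : S (Q x) = x := DFunLike.congr_fun hQ x
  rw [map_sub, e1, e2, sub_add_cancel]

theorem inv {R : ℕ → H →L[ℂ] H} {Q : H →L[ℂ] H} (h : StrongStarTendsto T S) {C : ℝ}
    (hC : ∀ n, ‖R n‖ ≤ C) (hR : ∀ n, R n * T n = 1) (hR' : ∀ n, T n * R n = 1)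
    (hQ : Q * S = 1) (hQ' : S * Q = 1) : StrongStarTendsto R Q :=
  ⟨⟨C, hC⟩, tendsto_inv h.tendsto hC hR hQ',
    tendsto_inv h.tendsto_star (C := C) (fun n ↦ (norm_star _).trans_le (hC n))
      (fun n ↦ by rw [← star_mul, hR' n, star_one]) (by rw [← star_mul, hQ, star_one])⟩

end StrongStarTendsto

variable {ι : Type*} (b : HilbertBasis ι ℂ H) {T : ℕ → H →L[ℂ] H} {S : H →L[ℂ] H}

theorem tendsto_hsSq_mul_left (h : StrongStarTendsto T S) {K : H →L[ℂ] H}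
    (hK : hsSq b K ≠ ∞) : Tendsto (fun n ↦ hsSq b (T n * K - S * K)) atTop (𝓝 0) := by
  obtain ⟨C, hC⟩ := (h.sub (.const S)).bdd
  have := tendsto_hsSq_comp b hK hC (S := fun n ↦ T n - S) fun x ↦ by
    simpa using (h.tendsto x).sub_const (S x)
  refine this.congr fun n ↦ ?_
  rw [← sub_mul]
  rfl

/-- Passing to adjoints reduces this to `tendsto_hsSq_mul_left`; strong convergence of `T n` alone
would not be enough. -/
theorem tendsto_hsSq_mul_right (h : StrongStarTendsto T S) {K : H →L[ℂ] H}
    (hK : hsSq b K ≠ ∞) : Tendsto (fun n ↦ hsSq b (K * T n - K * S)) atTop (𝓝 0) := by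
  refine (tendsto_hsSq_mul_left b h.star (K := star K) ?_).congr fun n ↦ ?_
  · rwa [ContinuousLinearMap.star_eq_adjoint, hsSq_adjoint]
  · rw [← star_mul, ← star_mul, ← star_sub, ContinuousLinearMap.star_eq_adjoint, hsSq_adjoint]

end StrongStar

/-! ### An abstract Dirac-Schrödinger operator -/

section Abstract

variable {H : Type*} [NormedAddCommGroup H] [InnerProductSpace ℂ H]

theorem IsResolvent.eq {T : H →ₗ.[ℂ] H} {z : ℂ} {R R' : H →L[ℂ] H} (h : IsResolvent T z R)
    (h' : IsResolvent T z R') : R = R' := by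
  ext f
  obtain ⟨hd, hf⟩ := h'.1 f
  have := h.2 ⟨R' f, hd⟩
  rwa [hf] at this

theorem IsResolvent.resolventOp_eq {T : H →ₗ.[ℂ] H} {z : ℂ} {R : H →L[ℂ] H}
    (h : IsResolvent T z R) : resolventOp T z = R := by
  have hex : ∃ R, IsResolvent T z R := ⟨R, h⟩
  rw [resolventOp, dif_pos hex]
  exact hex.choose_spec.eq h

/-- `T` is the operator `P J⁻¹` with domain the range of the injective operator `J`. -/
structure HasGraph (T : H →ₗ.[ℂ] H) (J P : H →L[ℂ] H) : Prop where
  mem_iff : ∀ x, x ∈ T.domain ↔ ∃ a, J a = x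
  apply_eq : ∀ a (h : J a ∈ T.domain), T ⟨J a, h⟩ = P a

theorem HasGraph.mem {T : H →ₗ.[ℂ] H} {J P : H →L[ℂ] H} (h : HasGraph T J P) (a : H) :
    J a ∈ T.domain := (h.mem_iff _).2 ⟨a, rfl⟩

theorem HasGraph.apply_of_eq {T : H →ₗ.[ℂ] H} {J P : H →L[ℂ] H} (h : HasGraph T J P) {a x : H}
    (hx : J a = x) {hm : x ∈ T.domain} : T ⟨x, hm⟩ = P a := by
  subst hx
  exact h.apply_eq a hm

theorem mem_opComp_domain {S T : H →ₗ.[ℂ] H} {x : H} :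
    x ∈ (opComp S T).domain ↔ ∃ h : x ∈ T.domain, T ⟨x, h⟩ ∈ S.domain :=
  ⟨fun ⟨y, hy, hx⟩ ↦ by subst hx; exact ⟨y.2, hy⟩, fun ⟨h, h'⟩ ↦ ⟨⟨x, h⟩, h', rfl⟩⟩

theorem opComp_apply (S T : H →ₗ.[ℂ] H) {x : H} (h : x ∈ T.domain) (h' : T ⟨x, h⟩ ∈ S.domain)
    {hx : x ∈ (opComp S T).domain} : opComp S T ⟨x, hx⟩ = S ⟨T ⟨x, h⟩, h'⟩ := rfl

variable [CompleteSpace H]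

/-- Bounded operators that encode `D = D₀ + B` for a normal operator `D₀`: `J` is the smoothing
operator with range the domain of `D₀`, `G = D₀ J`, and the hypothesis `comm` says that
`D₀* B = B D₀* + C` on the range of `J`. The relation `G* G = κ (1 - J²)` fixes `J` as
`(1 + D₀* D₀ / κ)^(-1/2)`. -/
structure IsModel (κ : ℝ) (J G B C : H →L[ℂ] H) : Prop where
  kappa_pos : 0 < κ
  J_star : star J = J
  J_inj : Function.Injective J
  B_star : star B = B
  star_G_mul_G : star G * G = (κ : ℂ) • (1 - J * J)
  G_mul_star_G : G * star G = (κ : ℂ) • (1 - J * J)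
  G_comm : G * J = J * G
  comm : star G * B * J = J * B * star G + J * C * J

/-- The bounded operator `J (D* D - z) J`, where `D J = G + B J`. -/
noncomputable def formOp (J G B : H →L[ℂ] H) (z : ℂ) : H →L[ℂ] H :=
  star (G + B * J) * (G + B * J) - z • (J * J)

/-- The inverse of `formOp`. -/
noncomputable def formInv (J G B : H →L[ℂ] H) (z : ℂ) : H →L[ℂ] H :=
  Ring.inverse (formOp J G B z)

/-- The resolvent `(D* D - z)⁻¹`. -/
noncomputable def modelRes (J G B : H →L[ℂ] H) (z : ℂ) : H →L[ℂ] H :=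
  J * formInv J G B z * J

/-- The lower order part of `formOp`, with one factor `J` removed: see `IsModel.formOp_eq`. -/
noncomputable def lowerOp (κ : ℝ) (J G B C : H →L[ℂ] H) (z : ℂ) : H →L[ℂ] H :=
  (κ + z) • J - B * star G - C * J - B * G - B * B * J

/-- The bounded operator `J⁻² (D* D - z)⁻¹`: see `IsModel.modelRes_eq`. -/
noncomputable def regOp (κ : ℝ) (J G B C : H →L[ℂ] H) (z : ℂ) : H →L[ℂ] H :=
  (κ : ℂ)⁻¹ • (1 + lowerOp κ J G B C z * formInv J G B z * J)

theorem star_notMem_Ici {z : ℂ}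
    (hz : z ∉ ((fun r : ℝ ↦ (r : ℂ)) '' Set.Ici 0)) :
    star z ∉ ((fun r : ℝ ↦ (r : ℂ)) '' Set.Ici 0) := by
  rintro ⟨r, hr, h⟩
  refine hz ⟨r, hr, ?_⟩
  have := congrArg star h
  simpa using this

/-- The distance of `z` from the ray `[0, ∞)`, in homogeneous form. -/
theorem exists_pos_mul_add_le_norm_sub {z : ℂ} (hz : z ∉ ((fun r : ℝ ↦ (r : ℂ)) '' Set.Ici 0)) :
    ∃ c : ℝ, 0 < c ∧ ∀ p q : ℝ, 0 ≤ p → 0 ≤ q → c * (p + q) ≤ ‖(p : ℂ) - z * q‖ := by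
  -- by homogeneity it is enough to consider the segment `p + q = 1`, which is compact
  have hcont : ContinuousOn (fun s : ℝ ↦ ‖(s : ℂ) - z * ((1 - s : ℝ) : ℂ)‖) (Set.Icc 0 1) := by
    fun_prop
  obtain ⟨s₀, hs₀, hmin⟩ := isCompact_Icc.exists_isMinOn (Set.nonempty_Icc.2 zero_le_one) hcont
  refine ⟨‖(s₀ : ℂ) - z * ((1 - s₀ : ℝ) : ℂ)‖, ?_, fun p q hp hq ↦ ?_⟩
  · rw [norm_pos_iff]
    intro h0
    rcases eq_or_lt_of_le hs₀.2 with h1 | h1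
    · simp [h1] at h0
    · apply hz
      refine ⟨s₀ / (1 - s₀), div_nonneg hs₀.1 (by linarith), ?_⟩
      have h2 : ((1 - s₀ : ℝ) : ℂ) ≠ 0 := by
        rw [Complex.ofReal_ne_zero]
        linarith
      simp only [Complex.ofReal_div]
      rw [div_eq_iff h2]
      exact sub_eq_zero.1 h0
  · rcases eq_or_lt_of_le (add_nonneg hp hq) with h | h
    · simp [← h]
    · have hmem : p / (p + q) ∈ Set.Icc (0 : ℝ) 1 :=
        ⟨by positivity, (div_le_one h).2 (by linarith)⟩
      have h1 := isMinOn_iff.1 hmin _ hmem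
      have h2 : 1 - p / (p + q) = q / (p + q) := by
        field_simp
        ring
      simp only [h2] at h1
      rw [← le_div_iff₀ h]
      refine h1.trans_eq ?_
      rw [← Complex.norm_of_nonneg h.le, ← norm_div, Complex.norm_of_nonneg h.le]
      congr 1
      push_cast
      ring

theorem inner_star_left (T : H →L[ℂ] H) (x y : H) : inner ℂ (star T x) y = inner ℂ x (T y) := by
  rw [ContinuousLinearMap.star_eq_adjoint, ContinuousLinearMap.adjoint_inner_left]

namespace IsModel

variable {κ : ℝ} {J G B C : H →L[ℂ] H}

theorem inner_J (h : IsModel κ J G B C) (x y : H) : inner ℂ (J x) y = inner ℂ x (J y) := by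
  nth_rewrite 1 [← h.J_star]
  exact inner_star_left J x y

theorem star_G_comm (h : IsModel κ J G B C) : star G * J = J * star G := by
  have := congrArg star h.G_comm
  rwa [star_mul, star_mul, h.J_star, eq_comm] at this

theorem star_formOp (h : IsModel κ J G B C) (z : ℂ) :
    star (formOp J G B z) = formOp J G B (star z) := by
  simp [formOp, h.J_star]

theorem formOp_eq (h : IsModel κ J G B C) (z : ℂ) :
    formOp J G B z = (κ : ℂ) • 1 - J * lowerOp κ J G B C z := by
  rw [formOp, lowerOp, star_add, star_mul, h.J_star, h.B_star, add_mul, mul_add, mul_add,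
    h.star_G_mul_G, ← mul_assoc, h.comm]
  simp only [smul_sub, add_smul, mul_sub, mul_add, mul_smul_comm, mul_assoc]
  abel

theorem norm_sq_eq (h : IsModel κ J G B C) (a : H) :
    κ * ‖a‖ ^ 2 = ‖G a‖ ^ 2 + κ * ‖J a‖ ^ 2 := by
  have h1 : inner ℂ ((star G * G) a) a = ((‖G a‖ ^ 2 : ℝ) : ℂ) := by
    rw [mul_apply_eq_comp, inner_star_left, inner_self_eq_norm_sq_to_K]
    norm_cast
  have h2 : inner ℂ ((J * J) a) a = ((‖J a‖ ^ 2 : ℝ) : ℂ) := by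
    rw [mul_apply_eq_comp, h.inner_J, inner_self_eq_norm_sq_to_K]
    norm_cast
  rw [h.star_G_mul_G, smul_apply, sub_apply, inner_smul_left, inner_sub_left, h2, one_apply_eq_self,
    inner_self_eq_norm_sq_to_K, Complex.conj_ofReal] at h1
  have h3 : κ * (‖a‖ ^ 2 - ‖J a‖ ^ 2) = ‖G a‖ ^ 2 := by
    apply Complex.ofReal_injective
    push_cast
    push_cast at h1
    exact h1
  linarith

theorem inner_formOp (h : IsModel κ J G B C) (z : ℂ) (a : H) :
    inner ℂ (formOp J G B z a) a
      = ((‖(G + B * J) a‖ ^ 2 : ℝ) : ℂ) - star z * ((‖J a‖ ^ 2 : ℝ) : ℂ) := by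
  have h2 : inner ℂ ((J * J) a) a = ((‖J a‖ ^ 2 : ℝ) : ℂ) := by
    rw [mul_apply_eq_comp, h.inner_J, inner_self_eq_norm_sq_to_K]
    norm_cast
  rw [formOp, sub_apply, inner_sub_left, smul_apply, inner_smul_left, h2,
    mul_apply_eq_comp, inner_star_left, inner_self_eq_norm_sq_to_K]
  norm_cast

/-- The coercivity estimate behind the existence of the resolvents. The constant depends on `B`
only through a bound for its norm. -/
theorem exists_coercive (κ : ℝ) {z : ℂ} (hz : z ∉ ((fun r : ℝ ↦ (r : ℂ)) '' Set.Ici 0)) (β : ℝ) :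
    ∃ c : ℝ, 0 < c ∧ ∀ {J G B C : H →L[ℂ] H}, IsModel κ J G B C → ‖B‖ ≤ β →
      ∀ a, ‖a‖ ^ 2 * c ≤ ‖inner ℂ (formOp J G B z a) a‖ := by
  obtain ⟨c, hc, hle⟩ := exists_pos_mul_add_le_norm_sub (star_notMem_Ici hz)
  by_cases hκ : 0 < κ
  swap
  · exact ⟨1, one_pos, fun h ↦ absurd h.kappa_pos hκ⟩
  set m := 2 + 2 * β ^ 2 + κ with hm
  have hm0 : 0 < m := by positivity
  refine ⟨c * (κ / m), by positivity, fun {J G B C} h hB a ↦ ?_⟩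
  rw [h.inner_formOp]
  refine le_trans ?_ (hle _ _ (by positivity) (by positivity))
  set p := ‖(G + B * J) a‖ with hp
  set q := ‖J a‖ with hq
  have h1 : ‖G a‖ ≤ p + β * q := by
    have e : G a = (G + B * J) a - B (J a) := by simp
    rw [e]
    refine (norm_sub_le _ _).trans (add_le_add le_rfl (B.le_of_opNorm_le hB _))
  have h2 : ‖G a‖ ^ 2 ≤ 2 * p ^ 2 + 2 * β ^ 2 * q ^ 2 := by
    have : ‖G a‖ ^ 2 ≤ (p + β * q) ^ 2 := by gcongr
    nlinarith [sq_nonneg (p - β * q)]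
  have h3 := h.norm_sq_eq a
  have h4 : κ * ‖a‖ ^ 2 ≤ m * (p ^ 2 + q ^ 2) := by
    rw [h3, hm]
    nlinarith [sq_nonneg p, sq_nonneg q, mul_nonneg (sq_nonneg β) (sq_nonneg p),
      mul_nonneg hκ.le (sq_nonneg p)]
  have h5 : ‖a‖ ^ 2 * (κ / m) ≤ p ^ 2 + q ^ 2 := by
    rw [← mul_div_assoc, div_le_iff₀ hm0]
    linarith
  calc ‖a‖ ^ 2 * (c * (κ / m)) = c * (‖a‖ ^ 2 * (κ / m)) := by ring
    _ ≤ _ := by gcongr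

theorem isUnit_formOp (h : IsModel κ J G B C) {z : ℂ}
    (hz : z ∉ ((fun r : ℝ ↦ (r : ℂ)) '' Set.Ici 0)) : IsUnit (formOp J G B z) := by
  obtain ⟨c, hc, hle⟩ := exists_coercive (H := H) κ hz ‖B‖
  exact ContinuousLinearMap.isUnit_of_forall_le_norm_inner_map _ (c := ⟨c, hc.le⟩) hc
    (hle h le_rfl)

theorem formInv_mul (h : IsModel κ J G B C) {z : ℂ}
    (hz : z ∉ ((fun r : ℝ ↦ (r : ℂ)) '' Set.Ici 0)) :
    formInv J G B z * formOp J G B z = 1 := Ring.inverse_mul_cancel _ (h.isUnit_formOp hz)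

theorem mul_formInv (h : IsModel κ J G B C) {z : ℂ}
    (hz : z ∉ ((fun r : ℝ ↦ (r : ℂ)) '' Set.Ici 0)) :
    formOp J G B z * formInv J G B z = 1 := Ring.mul_inverse_cancel _ (h.isUnit_formOp hz)

/-- The bound for `formInv` is uniform in `B`, as long as `‖B‖` is bounded. -/
theorem exists_norm_formInv_le (κ : ℝ) {z : ℂ}
    (hz : z ∉ ((fun r : ℝ ↦ (r : ℂ)) '' Set.Ici 0)) (β : ℝ) :
    ∃ K : ℝ, ∀ {J G B C : H →L[ℂ] H}, IsModel κ J G B C → ‖B‖ ≤ β → ‖formInv J G B z‖ ≤ K := by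
  obtain ⟨c, hc, hle⟩ := exists_coercive (H := H) κ hz β
  refine ⟨c⁻¹, fun {J G B C} h hB ↦ ContinuousLinearMap.opNorm_le_bound _ (by positivity)
    fun f ↦ ?_⟩
  set a := formInv J G B z f with ha
  have hf : formOp J G B z a = f := DFunLike.congr_fun (h.mul_formInv hz) f
  have h1 := hle h hB a
  rw [hf] at h1
  have h2 := h1.trans (norm_inner_le_norm f a)
  rcases eq_or_lt_of_le (norm_nonneg a) with h0 | h0
  · rw [← h0]
    positivity
  · rw [← div_eq_inv_mul, le_div_iff₀ hc]
    nlinarith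

/-- Elliptic regularity: the resolvent factors through `J²`. -/
theorem modelRes_eq (h : IsModel κ J G B C) {z : ℂ}
    (hz : z ∉ ((fun r : ℝ ↦ (r : ℂ)) '' Set.Ici 0)) :
    modelRes J G B z = J * J * regOp κ J G B C z := by
  have hκ : (κ : ℂ) ≠ 0 := Complex.ofReal_ne_zero.2 h.kappa_pos.ne'
  have h1 := h.mul_formInv hz
  rw [h.formOp_eq, sub_mul, smul_mul_assoc, one_mul, sub_eq_iff_eq_add] at h1
  have h2 : formInv J G B z = (κ : ℂ)⁻¹ • (1 + J * lowerOp κ J G B C z * formInv J G B z) := by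
    rw [← h1, smul_smul, inv_mul_cancel₀ hκ, one_smul]
  rw [modelRes]
  nth_rewrite 1 [h2]
  rw [regOp]
  simp only [smul_mul_assoc, mul_smul_comm, mul_add, add_mul, mul_one, mul_assoc]

theorem star_modelRes (h : IsModel κ J G B C) (z : ℂ) :
    star (modelRes J G B z) = modelRes J G B (star z) := by
  have h1 : star (formInv J G B z) = formInv J G B (star z) := by
    rw [formInv, formInv, ← Ring.inverse_star, h.star_formOp]
  rw [modelRes, modelRes, star_mul, star_mul, h.J_star, h1, mul_assoc]

theorem star_add_mul (h : IsModel κ J G B C) : star (G + B * J) = star G + J * B := by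
  rw [star_add, star_mul, h.J_star, h.B_star]

/-- The resolvent of `D* D`, if `D` and `D*` are given by their graphs. -/
theorem isResolvent_opComp (h : IsModel κ J G B C) {S S' : H →ₗ.[ℂ] H}
    (hS : HasGraph S J (G + B * J)) (hS' : HasGraph S' J (star G + B * J)) {z : ℂ}
    (hz : z ∉ ((fun r : ℝ ↦ (r : ℂ)) '' Set.Ici 0)) :
    IsResolvent (opComp S' S) z (modelRes J G B z) := by
  have hκ : (κ : ℂ) ≠ 0 := Complex.ofReal_ne_zero.2 h.kappa_pos.ne'
  have eG : ∀ x, star G (G x) = (κ : ℂ) • (x - J (J x)) :=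
    fun x ↦ DFunLike.congr_fun h.star_G_mul_G x
  have eG' : ∀ x, G (star G x) = (κ : ℂ) • (x - J (J x)) :=
    fun x ↦ DFunLike.congr_fun h.G_mul_star_G x
  have eJ : ∀ x, G (J x) = J (G x) := fun x ↦ DFunLike.congr_fun h.G_comm x
  have eJ' : ∀ x, star G (J x) = J (star G x) := fun x ↦ DFunLike.congr_fun h.star_G_comm x
  have eM : ∀ a, formOp J G B z a
      = star G ((G + B * J) a) + J (B ((G + B * J) a)) - z • J (J a) := fun a ↦ by
    rw [formOp, h.star_add_mul]
    rfl
  constructor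
  · intro f
    set a := formInv J G B z (J f) with ha
    have hR : modelRes J G B z f = J a := rfl
    have hMa : formOp J G B z a = J f := DFunLike.congr_fun (h.mul_formInv hz) (J f)
    set y := (G + B * J) a with hy
    set w := f + z • J a - B y with hw
    have hGy : star G y = J w := by
      rw [eM] at hMa
      rw [hw, map_sub, map_add, map_smul, ← hMa]
      abel
    -- `D J a` is in the domain of `D*`, because `D₀* D J a ∈ L²`
    set b := (κ : ℂ)⁻¹ • G w + J y with hb
    have hyb : J b = y := by
      have h1 := eG' y
      rw [hGy, eJ] at h1
      rw [hb, map_add, map_smul, h1, smul_smul, inv_mul_cancel₀ hκ, one_smul, sub_add_cancel]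
    have hb' : (star G + B * J) b = f + z • J a := by
      have h1 : star G b = w := by
        rw [hb, map_add, map_smul, eG, smul_smul, inv_mul_cancel₀ hκ, one_smul, eJ', hGy,
          sub_add_cancel]
      have h2 : (star G + B * J) b = star G b + B (J b) := rfl
      rw [h2, h1, hyb, hw, sub_add_cancel]
    have hSa : S ⟨J a, hS.mem a⟩ = J b := by rw [hS.apply_eq, hyb]
    have hmem : S ⟨J a, hS.mem a⟩ ∈ S'.domain := hSa ▸ hS'.mem b
    rw [hR]
    refine ⟨mem_opComp_domain.2 ⟨hS.mem a, hmem⟩, ?_⟩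
    rw [opComp_apply _ _ (hS.mem a) hmem, hS'.apply_of_eq hSa.symm, hb', add_sub_cancel_right]
  · rintro ⟨x, hx⟩
    obtain ⟨hxS, hxS'⟩ := mem_opComp_domain.1 hx
    obtain ⟨a, rfl⟩ := (hS.mem_iff x).1 hxS
    obtain ⟨b, hb⟩ := (hS'.mem_iff _).1 hxS'
    rw [opComp_apply _ _ hxS hxS', hS'.apply_of_eq hb]
    have hy : (G + B * J) a = J b := by rw [hb, hS.apply_eq]
    have h1 : J ((star G + B * J) b - z • J a) = formOp J G B z a := by
      rw [eM, hy, eJ', map_sub, map_smul]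
      congr 1
      exact map_add J _ _
    have h2 : formInv J G B z (formOp J G B z a) = a := DFunLike.congr_fun (h.formInv_mul hz) a
    change J (formInv J G B z (J ((star G + B * J) b - z • J a))) = J a
    rw [h1, h2]

/-- The resolvent of an operator `T` with domain the range of `J²`. The hypothesis on `P = T J²`
says that `J (T - z) J` and `formOp` agree on the range of `J`. -/
theorem isResolvent_of_hasGraph (h : IsModel κ J G B C) {T : H →ₗ.[ℂ] H} {P : H →L[ℂ] H} {z : ℂ}
    (hT : HasGraph T (J * J) P) (hP : J * P = formOp J G B z * J + z • (J * J * J))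
    (hz : z ∉ ((fun r : ℝ ↦ (r : ℂ)) '' Set.Ici 0)) :
    IsResolvent T z (modelRes J G B z) := by
  have hP' : ∀ c, J (P c - z • J (J c)) = formOp J G B z (J c) := fun c ↦ by
    have h1 : J (P c) = formOp J G B z (J c) + z • J (J (J c)) := DFunLike.congr_fun hP c
    rw [map_sub, h1, map_smul, add_sub_cancel_right]
  constructor
  · intro f
    have hR : modelRes J G B z f = (J * J) (regOp κ J G B C z f) := by
      rw [h.modelRes_eq hz]
      rfl
    have hR' : J (J (regOp κ J G B C z f)) = J (formInv J G B z (J f)) := hR.symm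
    refine ⟨hR ▸ hT.mem _, ?_⟩
    rw [hT.apply_of_eq hR.symm, hR]
    apply h.J_inj
    change J (P _ - z • J (J _)) = _
    rw [hP', h.J_inj hR']
    exact DFunLike.congr_fun (h.mul_formInv hz) (J f)
  · rintro ⟨x, hx⟩
    obtain ⟨c, rfl⟩ := (hT.mem_iff x).1 hx
    rw [hT.apply_eq]
    change J (formInv J G B z (J (P c - z • J (J c)))) = J (J c)
    rw [hP']
    congr 1
    exact DFunLike.congr_fun (h.formInv_mul hz) (J c)

theorem dense_range (h : IsModel κ J G B C) : Dense (LinearMap.range J.toLinearMap : Set H) := by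
  rw [Submodule.dense_iff_topologicalClosure_eq_top, Submodule.topologicalClosure_eq_top_iff,
    Submodule.eq_bot_iff]
  intro x hx
  apply h.J_inj
  rw [map_zero, ← inner_self_eq_zero (𝕜 := ℂ)]
  have h1 := hx (J (J x)) ⟨_, rfl⟩
  rwa [h.inner_J] at h1

/-- The adjoint of `D₀ + B` is `D₀* + B`, on the same domain. -/
theorem hasGraph_adjoint (h : IsModel κ J G B C) {S : H →ₗ.[ℂ] H}
    (hS : HasGraph S J (G + B * J)) : HasGraph S.adjoint J (star G + B * J) := by
  have hκ : (κ : ℂ) ≠ 0 := Complex.ofReal_ne_zero.2 h.kappa_pos.ne'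
  have hdom : S.domain = LinearMap.range J.toLinearMap := by
    ext x
    exact hS.mem_iff x
  have hd : Dense (S.domain : Set H) := hdom ▸ h.dense_range
  have hinner : ∀ b a, inner ℂ ((star G + B * J) b) (J a) = inner ℂ (J b) ((G + B * J) a) := by
    intro b a
    have e : J * (star G + B * J) = star (G + B * J) * J := by
      rw [h.star_add_mul, mul_add, add_mul, h.star_G_comm, mul_assoc]
    have e' : J ((star G + B * J) b) = star (G + B * J) (J b) := DFunLike.congr_fun e b
    rw [← h.inner_J, e', inner_star_left]
  have hall : ∀ b (x : S.domain), inner ℂ ((star G + B * J) b) (x : H) = inner ℂ (J b) (S x) := by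
    rintro b ⟨x, hx⟩
    obtain ⟨a, rfl⟩ := (hS.mem_iff x).1 hx
    rw [hS.apply_eq]
    exact hinner b a
  refine ⟨fun y ↦ ⟨fun hy ↦ ?_, ?_⟩, fun b hb ↦ LinearPMap.adjoint_apply_eq hd _ (hall b)⟩
  · set w := S.adjoint ⟨y, hy⟩ with hw
    have h1 : star (G + B * J) y = J w := by
      refine ext_inner_right ℂ fun a ↦ ?_
      have h2 := LinearPMap.adjoint_isFormalAdjoint hd ⟨y, hy⟩ ⟨J a, hS.mem a⟩
      rw [hS.apply_eq] at h2
      rw [inner_star_left, h.inner_J]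
      exact h2.symm
    have h2 : star G y = J (w - B y) := by
      rw [h.star_add_mul] at h1
      have h3 : star G y + J (B y) = J w := h1
      rw [map_sub, ← h3, add_sub_cancel_right]
    refine ⟨(κ : ℂ)⁻¹ • G (w - B y) + J y, ?_⟩
    have h3 : G (star G y) = (κ : ℂ) • (y - J (J y)) := DFunLike.congr_fun h.G_mul_star_G y
    have h4 : G (J (w - B y)) = J (G (w - B y)) := DFunLike.congr_fun h.G_comm _
    rw [h2, h4] at h3
    rw [map_add, map_smul, h3, smul_smul, inv_mul_cancel₀ hκ, one_smul, sub_add_cancel]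
  · rintro ⟨b, rfl⟩
    exact LinearPMap.mem_adjoint_domain_of_exists _ ⟨_, hall b⟩

/-- The second resolvent identity enters through `StrongStarTendsto.inv`, with the uniform bound
for the inverses from `exists_norm_formInv_le`. -/
theorem strongStarTendsto_regOp {Bn Cn : ℕ → H →L[ℂ] H} (h : IsModel κ J G B C)
    (hn : ∀ n, IsModel κ J G (Bn n) (Cn n)) (hB : StrongStarTendsto Bn B)
    (hC : StrongStarTendsto Cn C) {z : ℂ} (hz : z ∉ ((fun r : ℝ ↦ (r : ℂ)) '' Set.Ici 0)) :
    StrongStarTendsto (fun n ↦ regOp κ J G (Bn n) (Cn n) z) (regOp κ J G B C z) := by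
  have hJ := StrongStarTendsto.const J
  have hG := StrongStarTendsto.const G
  have hform : StrongStarTendsto (fun n ↦ formOp J G (Bn n) z) (formOp J G B z) :=
    ((hG.add (hB.mul hJ)).star.mul (hG.add (hB.mul hJ))).sub ((hJ.mul hJ).smul z)
  obtain ⟨β, hβ⟩ := hB.bdd
  obtain ⟨K, hK⟩ := exists_norm_formInv_le (H := H) κ hz β
  have hinv : StrongStarTendsto (fun n ↦ formInv J G (Bn n) z) (formInv J G B z) :=
    hform.inv (fun n ↦ hK (hn n) (hβ n)) (fun n ↦ (hn n).formInv_mul hz)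
      (fun n ↦ (hn n).mul_formInv hz) (h.formInv_mul hz) (h.mul_formInv hz)
  have hlow : StrongStarTendsto (fun n ↦ lowerOp κ J G (Bn n) (Cn n) z) (lowerOp κ J G B C z) :=
    ((((hJ.smul _).sub (hB.mul hG.star)).sub (hC.mul hJ)).sub (hB.mul hG)).sub
      ((hB.mul hB).mul hJ)
  exact ((StrongStarTendsto.const 1).add ((hlow.mul hinv).mul hJ)).smul _

end IsModel

end Abstract

/-! ### Multiplication operators and Fourier multipliers -/

section Multipliers

theorem coeFn_mulOp {m : Plane → ℂ} (hm : MemLp m ∞ (volume : Measure Plane)) (f : L2) :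
    mulOp m f =ᵐ[volume] fun p ↦ m p * f p := by
  rw [mulOp, dif_pos hm]
  have h := ContinuousLinearMap.coeFn_holder (r := 2) (ContinuousLinearMap.mul ℂ ℂ) (hm.toLp m) f
  filter_upwards [h, hm.coeFn_toLp] with p h1 h2
  change ContinuousLinearMap.holder 2 (ContinuousLinearMap.mul ℂ ℂ) (hm.toLp m) f p = _
  rw [h1, h2]
  rfl

theorem norm_sq_eq_integral (f : L2) : ‖f‖ ^ 2 = ∫ p, ‖f p‖ ^ 2 := by
  have h := L2.inner_def (𝕜 := ℂ) f f
  rw [inner_self_eq_norm_sq_to_K] at h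
  have h2 : (∫ p, inner ℂ (f p) (f p)) = ((∫ p, ‖f p‖ ^ 2 : ℝ) : ℂ) := by
    refine Eq.trans ?_ (integral_ofReal (𝕜 := ℂ))
    congr with p
    rw [inner_self_eq_norm_sq_to_K]
    norm_cast
  rw [h2] at h
  apply Complex.ofReal_injective
  rw [Complex.ofReal_pow]
  exact h

theorem integrable_norm_sq (f : L2) : Integrable fun p ↦ ‖f p‖ ^ 2 :=
  (Lp.memLp f).integrable_norm_pow (by norm_num)

theorem mulOp_add {m m' : Plane → ℂ} (hm : MemLp m ∞ (volume : Measure Plane))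
    (hm' : MemLp m' ∞ (volume : Measure Plane)) : mulOp (m + m') = mulOp m + mulOp m' := by
  ext1 f
  apply Lp.ext
  filter_upwards [coeFn_mulOp hm f, coeFn_mulOp hm' f, coeFn_mulOp (hm.add hm') f,
    Lp.coeFn_add (mulOp m f) (mulOp m' f)] with p h1 h2 h3 h4
  rw [h3, add_apply, h4, Pi.add_apply, Pi.add_apply, h1, h2, add_mul]

theorem mulOp_smul (c : ℂ) {m : Plane → ℂ} (hm : MemLp m ∞ (volume : Measure Plane)) :
    mulOp (c • m) = c • mulOp m := by
  ext1 f
  apply Lp.ext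
  filter_upwards [coeFn_mulOp hm f, coeFn_mulOp (hm.const_smul c) f,
    Lp.coeFn_smul c (mulOp m f)] with p h1 h2 h3
  rw [h2, smul_apply, h3, Pi.smul_apply, Pi.smul_apply, h1, smul_eq_mul, smul_eq_mul, mul_assoc]

theorem mulOp_mul {m m' : Plane → ℂ} (hm : MemLp m ∞ (volume : Measure Plane))
    (hm' : MemLp m' ∞ (volume : Measure Plane)) : mulOp (m * m') = mulOp m * mulOp m' := by
  ext1 f
  apply Lp.ext
  filter_upwards [coeFn_mulOp hm (mulOp m' f), coeFn_mulOp hm' f,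
    coeFn_mulOp (hm'.mul hm) f] with p h1 h2 h3
  rw [h3, mul_apply_eq_comp, h1, h2, Pi.mul_apply, mul_assoc]

theorem memLp_top_one : MemLp (1 : Plane → ℂ) ∞ (volume : Measure Plane) :=
  memLp_top_const 1

theorem mulOp_one : mulOp 1 = 1 := by
  ext1 f
  apply Lp.ext
  filter_upwards [coeFn_mulOp memLp_top_one f] with p h1
  rw [h1, Pi.one_apply, one_mul]
  rfl

theorem star_mulOp {m : Plane → ℂ} (hm : MemLp m ∞ (volume : Measure Plane)) :
    star (mulOp m) = mulOp (star m) := by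
  refine ContinuousLinearMap.ext fun f ↦ ext_inner_right ℂ fun g ↦ ?_
  rw [inner_star_left, L2.inner_def, L2.inner_def]
  refine integral_congr_ae ?_
  filter_upwards [coeFn_mulOp hm g, coeFn_mulOp hm.star f] with p h1 h2
  rw [h1, h2, RCLike.inner_apply, RCLike.inner_apply, map_mul, Pi.star_apply, RCLike.star_def,
    RCLike.conj_conj]
  ring

theorem norm_mulOp_le {m : Plane → ℂ} (hm : MemLp m ∞ (volume : Measure Plane)) {C : ℝ}
    (hC : ∀ p, ‖m p‖ ≤ C) : ‖mulOp m‖ ≤ C := by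
  have hC0 : 0 ≤ C := (norm_nonneg _).trans (hC 0)
  refine ContinuousLinearMap.opNorm_le_bound _ hC0 fun f ↦ ?_
  refine Lp.norm_le_mul_norm_of_ae_le_mul ?_
  filter_upwards [coeFn_mulOp hm f] with p h1
  rw [h1, norm_mul]
  gcongr
  exact hC p

/-- Dominated convergence for multiplication operators. -/
theorem tendsto_mulOp {m : ℕ → Plane → ℂ} {m' : Plane → ℂ} {C : ℝ}
    (hm : ∀ n, MemLp (m n) ∞ (volume : Measure Plane)) (hm' : MemLp m' ∞ (volume : Measure Plane))
    (hC : ∀ n p, ‖m n p - m' p‖ ≤ C) (h : ∀ p, Tendsto (fun n ↦ m n p) atTop (𝓝 (m' p))) (f : L2) :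
    Tendsto (fun n ↦ mulOp (m n) f) atTop (𝓝 (mulOp m' f)) := by
  rw [tendsto_iff_norm_sub_tendsto_zero]
  have key : Tendsto (fun n ↦ ∫ p, ‖(mulOp (m n) f - mulOp m' f : L2) p‖ ^ 2) atTop
      (𝓝 (∫ _ : Plane, (0 : ℝ))) := by
    have hae : ∀ n, ∀ᵐ p, ‖(mulOp (m n) f - mulOp m' f : L2) p‖ = ‖m n p - m' p‖ * ‖f p‖ := by
      intro n
      filter_upwards [coeFn_mulOp (hm n) f, coeFn_mulOp hm' f,
        Lp.coeFn_sub (mulOp (m n) f) (mulOp m' f)] with p h1 h2 h3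
      rw [h3, Pi.sub_apply, h1, h2, ← sub_mul, norm_mul]
    refine tendsto_integral_of_dominated_convergence (fun p ↦ C ^ 2 * ‖f p‖ ^ 2)
      (fun n ↦ (integrable_norm_sq _).aestronglyMeasurable) ((integrable_norm_sq f).const_mul _)
      (fun n ↦ ?_) ?_
    · filter_upwards [hae n] with p hp
      rw [hp, Real.norm_of_nonneg (by positivity), mul_pow]
      gcongr
      exact hC n p
    · filter_upwards [ae_all_iff.2 hae] with p hp
      simp only [hp]
      have := (((h p).sub_const (m' p)).norm.mul_const ‖f p‖).pow 2
      simpa using this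
  simp only [← norm_sq_eq_integral, integral_zero] at key
  have := key.sqrt
  simpa [Real.sqrt_sq (norm_nonneg _)] using this

theorem strongStarTendsto_mulOp {m : ℕ → Plane → ℂ} {m' : Plane → ℂ} {C C' : ℝ}
    (hm : ∀ n, MemLp (m n) ∞ (volume : Measure Plane)) (hm' : MemLp m' ∞ (volume : Measure Plane))
    (hC' : ∀ n p, ‖m n p‖ ≤ C') (hC : ∀ n p, ‖m n p - m' p‖ ≤ C)
    (h : ∀ p, Tendsto (fun n ↦ m n p) atTop (𝓝 (m' p))) :
    StrongStarTendsto (fun n ↦ mulOp (m n)) (mulOp m') := by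
  refine ⟨⟨C', fun n ↦ norm_mulOp_le (hm n) (hC' n)⟩, tendsto_mulOp hm hm' hC h, fun f ↦ ?_⟩
  simp only [star_mulOp (hm _), star_mulOp hm']
  refine tendsto_mulOp (C := C) (fun n ↦ (hm n).star) hm'.star (fun n p ↦ ?_) (fun p ↦ ?_) f
  · rw [Pi.star_apply, Pi.star_apply, ← star_sub, norm_star]
    exact hC n p
  · exact (continuous_star.tendsto _).comp (h p)

/-- The Fourier transform on `L²(ℝ²)` as a bounded operator. -/
noncomputable def fourierOp : L2 →L[ℂ] L2 :=
  ((Lp.fourierTransformₗᵢ Plane ℂ) : L2 →L[ℂ] L2)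

theorem star_fourierOp :
    star fourierOp = ((Lp.fourierTransformₗᵢ Plane ℂ).symm : L2 →L[ℂ] L2) := by
  rw [ContinuousLinearMap.star_eq_adjoint, fourierOp]
  exact LinearIsometryEquiv.adjoint_eq_symm _

theorem fourierOp_mul_star : fourierOp * star fourierOp = 1 := by
  rw [star_fourierOp]
  ext1 f
  exact (Lp.fourierTransformₗᵢ Plane ℂ).apply_symm_apply f

theorem star_mul_fourierOp : star fourierOp * fourierOp = 1 := by
  rw [star_fourierOp]
  ext1 f
  exact (Lp.fourierTransformₗᵢ Plane ℂ).symm_apply_apply f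

theorem fourierMultiplier_eq (m : Plane → ℂ) :
    fourierMultiplier m = star fourierOp * mulOp m * fourierOp := by
  rw [star_fourierOp]
  rfl

theorem fourierOp_fourierMultiplier (m : Plane → ℂ) (f : L2) :
    fourierOp (fourierMultiplier m f) = mulOp m (fourierOp f) := by
  have h : fourierOp * fourierMultiplier m = mulOp m * fourierOp := by
    rw [fourierMultiplier_eq, mul_assoc, ← mul_assoc, fourierOp_mul_star, one_mul]
  exact DFunLike.congr_fun h f

theorem fourierOp_injective : Function.Injective fourierOp :=
  (Lp.fourierTransformₗᵢ Plane ℂ).injective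

theorem fourierMultiplier_add {m m' : Plane → ℂ} (hm : MemLp m ∞ (volume : Measure Plane))
    (hm' : MemLp m' ∞ (volume : Measure Plane)) :
    fourierMultiplier (m + m') = fourierMultiplier m + fourierMultiplier m' := by
  simp only [fourierMultiplier_eq, mulOp_add hm hm', mul_add, add_mul]

theorem fourierMultiplier_smul (c : ℂ) {m : Plane → ℂ}
    (hm : MemLp m ∞ (volume : Measure Plane)) :
    fourierMultiplier (c • m) = c • fourierMultiplier m := by
  simp only [fourierMultiplier_eq, mulOp_smul c hm, mul_smul_comm, smul_mul_assoc]

theorem fourierMultiplier_mul {m m' : Plane → ℂ} (hm : MemLp m ∞ (volume : Measure Plane))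
    (hm' : MemLp m' ∞ (volume : Measure Plane)) :
    fourierMultiplier (m * m') = fourierMultiplier m * fourierMultiplier m' := by
  refine ContinuousLinearMap.ext fun f ↦ fourierOp_injective ?_
  rw [mul_apply_eq_comp, fourierOp_fourierMultiplier, fourierOp_fourierMultiplier,
    fourierOp_fourierMultiplier, mulOp_mul hm hm']
  rfl

theorem fourierMultiplier_comm {m m' : Plane → ℂ} (hm : MemLp m ∞ (volume : Measure Plane))
    (hm' : MemLp m' ∞ (volume : Measure Plane)) :
    fourierMultiplier m * fourierMultiplier m' = fourierMultiplier m' * fourierMultiplier m := by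
  rw [← fourierMultiplier_mul hm hm', ← fourierMultiplier_mul hm' hm, mul_comm]

theorem fourierMultiplier_one : fourierMultiplier 1 = 1 := by
  rw [fourierMultiplier_eq, mulOp_one, mul_one, star_mul_fourierOp]

theorem star_fourierMultiplier {m : Plane → ℂ} (hm : MemLp m ∞ (volume : Measure Plane)) :
    star (fourierMultiplier m) = fourierMultiplier (star m) := by
  rw [fourierMultiplier_eq, fourierMultiplier_eq, star_mul, star_mul, star_star, star_mulOp hm,
    mul_assoc]

theorem strongStarTendsto_fourierMultiplier {m : ℕ → Plane → ℂ} {m' : Plane → ℂ} {C C' : ℝ}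
    (hm : ∀ n, MemLp (m n) ∞ (volume : Measure Plane)) (hm' : MemLp m' ∞ (volume : Measure Plane))
    (hC' : ∀ n p, ‖m n p‖ ≤ C') (hC : ∀ n p, ‖m n p - m' p‖ ≤ C)
    (h : ∀ p, Tendsto (fun n ↦ m n p) atTop (𝓝 (m' p))) :
    StrongStarTendsto (fun n ↦ fourierMultiplier (m n)) (fourierMultiplier m') := by
  simp only [fourierMultiplier_eq]
  exact ((StrongStarTendsto.const _).mul (strongStarTendsto_mulOp hm hm' hC' hC h)).mul (.const _)

end Multipliers

/-! ### Weak derivatives as Fourier multipliers -/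

section WeakDerivatives

theorem inner_unitVec (i : Fin 2) (ξ : Plane) : inner ℝ ξ (unitVec i) = ξ i := by
  simp [unitVec, EuclideanSpace.inner_single_right]

/-- A product of an `L²` function and a function of temperate growth, formed in the sense of
distributions, is in `L²` if and only if the pointwise product is. -/
theorem smulLeftCLM_eq_iff {h : Plane → ℂ} (hh : h.HasTemperateGrowth) (u v : L2) :
    TemperedDistribution.smulLeftCLM ℂ h (u : 𝓢'(Plane, ℂ)) = (v : 𝓢'(Plane, ℂ)) ↔
      v =ᵐ[volume] fun ξ ↦ h ξ * u ξ := by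
  have hcont : Continuous h := hh.1.continuous
  have hu : LocallyIntegrable (fun ξ ↦ h ξ * u ξ) volume :=
    ((Lp.memLp u).locallyIntegrable (by norm_num)).continuous_mul hcont
  have hv : LocallyIntegrable v volume := (Lp.memLp v).locallyIntegrable (by norm_num)
  constructor
  · intro heq
    refine ae_eq_of_integral_contDiff_smul_eq hv hu fun g g_smooth g_cpt ↦ ?_
    have hg₁ : HasCompactSupport (Complex.ofRealCLM ∘ g) := g_cpt.comp_left rfl
    have hg₂ : ContDiff ℝ ((⊤ : ℕ∞) : WithTop ℕ∞) (Complex.ofRealCLM ∘ g) := by fun_prop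
    have h1 := DFunLike.congr_fun heq (hg₁.toSchwartzMap hg₂)
    rw [TemperedDistribution.smulLeftCLM_apply_apply, Lp.toTemperedDistribution_apply,
      Lp.toTemperedDistribution_apply] at h1
    simp only [SchwartzMap.smulLeftCLM_apply_apply hh] at h1
    refine (Eq.trans ?_ h1.symm).trans ?_
    · congr with x
    · congr with x
      simp
      ring
  · intro hae
    ext ψ
    rw [TemperedDistribution.smulLeftCLM_apply_apply, Lp.toTemperedDistribution_apply,
      Lp.toTemperedDistribution_apply]
    refine integral_congr_ae ?_
    filter_upwards [hae] with x hx
    rw [SchwartzMap.smulLeftCLM_apply_apply hh, hx]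
    simp only [smul_eq_mul]
    ring

theorem lineDeriv_eq_iff (i : Fin 2) (u g : L2) :
    ∂_{unitVec i} (u : 𝓢'(Plane, ℂ)) = (g : 𝓢'(Plane, ℂ)) ↔
      fourierOp g =ᵐ[volume] fun ξ ↦ (2 * Real.pi * Complex.I * ξ i) * fourierOp u ξ := by
  have hT : (fun ξ : Plane ↦ ((inner ℝ ξ (unitVec i) : ℝ) : ℂ)).HasTemperateGrowth := by fun_prop
  have h1 : ∂_{unitVec i} (u : 𝓢'(Plane, ℂ)) = (g : 𝓢'(Plane, ℂ)) ↔
      𝓕 (∂_{unitVec i} (u : 𝓢'(Plane, ℂ))) = 𝓕 (g : 𝓢'(Plane, ℂ)) :=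
    ⟨fun h ↦ by rw [h], fun h ↦ by
      have := congrArg (fun T : 𝓢'(Plane, ℂ) ↦ 𝓕⁻ T) h
      simpa using this⟩
  rw [h1, TemperedDistribution.fourier_lineDerivOp_eq, Lp.fourier_toTemperedDistribution_eq,
    Lp.fourier_toTemperedDistribution_eq, ← smul_apply,
    ← TemperedDistribution.smulLeftCLM_smul hT, smulLeftCLM_eq_iff (by fun_prop)]
  refine Iff.of_eq ?_
  congr! 3 with ξ
  simp [inner_unitVec]

/-- The Fourier weight `(1 + |ξ|²)^(-1/2)`. -/
noncomputable def weight (ξ : Plane) : ℝ := (1 + ‖ξ‖ ^ 2) ^ (-(1 / 2) : ℝ)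

theorem weight_pos (ξ : Plane) : 0 < weight ξ := Real.rpow_pos_of_pos (by positivity) _

theorem weight_sq_mul (ξ : Plane) : weight ξ ^ 2 * (1 + ‖ξ‖ ^ 2) = 1 := by
  have h : (0 : ℝ) < 1 + ‖ξ‖ ^ 2 := by positivity
  rw [weight, ← Real.rpow_natCast, ← Real.rpow_mul h.le]
  norm_num
  rw [Real.rpow_neg_one, inv_mul_cancel₀ h.ne']

theorem norm_sq_plane (ξ : Plane) : ‖ξ‖ ^ 2 = ξ 0 ^ 2 + ξ 1 ^ 2 := by
  simp [EuclideanSpace.norm_sq_eq, Fin.sum_univ_two]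

theorem weight_sq_mul' (ξ : Plane) : weight ξ ^ 2 * (1 + (ξ 0 ^ 2 + ξ 1 ^ 2)) = 1 := by
  rw [← norm_sq_plane, weight_sq_mul]

theorem weight_le_one (ξ : Plane) : weight ξ ≤ 1 := by
  have := weight_sq_mul ξ
  nlinarith [weight_pos ξ, sq_nonneg ‖ξ‖, mul_nonneg (sq_nonneg (weight ξ)) (sq_nonneg ‖ξ‖)]

theorem abs_coord_mul_weight_le (i : Fin 2) (ξ : Plane) : |ξ i| * weight ξ ≤ 1 := by
  have h1 := weight_sq_mul' ξ
  have h2 : ξ i ^ 2 ≤ ξ 0 ^ 2 + ξ 1 ^ 2 := by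
    fin_cases i <;> simp [sq_nonneg]
  have h3 : |ξ i| * weight ξ * (|ξ i| * weight ξ) = weight ξ ^ 2 * ξ i ^ 2 := by
    rw [← sq_abs (ξ i)]
    ring
  have h4 : weight ξ ^ 2 * ξ i ^ 2 ≤ 1 := by
    nlinarith [mul_le_mul_of_nonneg_left h2 (sq_nonneg (weight ξ)), sq_nonneg (weight ξ)]
  exact abs_le_one_iff_mul_self_le_one.2 (h3.trans_le h4) |> le_of_abs_le

theorem continuous_weight : Continuous weight := by
  refine Continuous.rpow_const (by fun_prop) fun ξ ↦ .inl ?_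
  positivity

/-- The symbol of `J`. -/
noncomputable def symJ (ξ : Plane) : ℂ := weight ξ

/-- The symbol of `∂_i J`. -/
noncomputable def symG (i : Fin 2) (ξ : Plane) : ℂ := (2 * Real.pi * Complex.I * ξ i) * weight ξ

/-- The operator `(1 - Δ / 4π²)^(-1/2)`, which maps `L²` onto `W^{1,2}`. -/
noncomputable def opJ : L2 →L[ℂ] L2 := fourierMultiplier symJ

/-- The bounded operator `∂_i J`. -/
noncomputable def opG (i : Fin 2) : L2 →L[ℂ] L2 := fourierMultiplier (symG i)

theorem memLp_symJ : MemLp symJ ∞ (volume : Measure Plane) := by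
  refine memLp_top_of_bound (C := 1) ?_ (.of_forall fun ξ ↦ ?_)
  · exact (Complex.continuous_ofReal.comp continuous_weight).aestronglyMeasurable
  · rw [symJ, Complex.norm_of_nonneg (weight_pos ξ).le]
    exact weight_le_one ξ

theorem continuous_symG (i : Fin 2) : Continuous (symG i) := by
  have := continuous_weight
  unfold symG
  fun_prop

theorem norm_symG_le (i : Fin 2) (ξ : Plane) : ‖symG i ξ‖ ≤ 2 * Real.pi := by
  have h : ‖symG i ξ‖ = 2 * Real.pi * (|ξ i| * weight ξ) := by
    simp [symG, abs_of_pos Real.pi_pos, abs_of_pos (weight_pos ξ)]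
    ring
  rw [h]
  have := abs_coord_mul_weight_le i ξ
  have := Real.pi_pos
  nlinarith

theorem memLp_symG (i : Fin 2) : MemLp (symG i) ∞ (volume : Measure Plane) :=
  memLp_top_of_bound (continuous_symG i).aestronglyMeasurable _ (.of_forall (norm_symG_le i))

theorem star_opJ : star opJ = opJ := by
  rw [opJ, star_fourierMultiplier memLp_symJ]
  congr with ξ
  simp [symJ]

theorem star_opG (i : Fin 2) : star (opG i) = -opG i := by
  rw [opG, star_fourierMultiplier (memLp_symG i), ← neg_one_smul ℂ,
    ← fourierMultiplier_smul _ (memLp_symG i)]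
  congr with ξ
  simp [symG]

theorem opG_comm_opJ (i : Fin 2) : opG i * opJ = opJ * opG i :=
  fourierMultiplier_comm (memLp_symG i) memLp_symJ

theorem opG_comm (i j : Fin 2) : opG i * opG j = opG j * opG i :=
  fourierMultiplier_comm (memLp_symG i) (memLp_symG j)

/-- `∂_0² + ∂_1² = Δ = 4π² (1 - J⁻²)`, multiplied by `J²`. -/
theorem opG_sq_add : opG 0 * opG 0 + opG 1 * opG 1
    = -((4 * Real.pi ^ 2 : ℝ) : ℂ) • (1 - opJ * opJ) := by
  have h0 := (memLp_symG 0).mul (r := ∞) (memLp_symG 0)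
  have h1 := (memLp_symG 1).mul (r := ∞) (memLp_symG 1)
  have hJ := memLp_symJ.mul (r := ∞) memLp_symJ
  rw [opG, opG, opJ, ← fourierMultiplier_mul (memLp_symG 0) (memLp_symG 0),
    ← fourierMultiplier_mul (memLp_symG 1) (memLp_symG 1),
    ← fourierMultiplier_mul memLp_symJ memLp_symJ, ← fourierMultiplier_one,
    ← fourierMultiplier_add h0 h1, sub_eq_add_neg, ← neg_one_smul ℂ (fourierMultiplier (symJ * symJ)),
    ← fourierMultiplier_smul _ hJ, ← fourierMultiplier_add memLp_top_one (hJ.const_smul _),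
    ← fourierMultiplier_smul _ (memLp_top_one.add (hJ.const_smul _))]
  congr with ξ
  have h : (weight ξ : ℂ) ^ 2 * (1 + ((ξ 0 : ℂ) ^ 2 + (ξ 1 : ℂ) ^ 2)) = 1 := by
    exact_mod_cast weight_sq_mul' ξ
  simp only [symG, symJ, Pi.add_apply, Pi.mul_apply, Pi.smul_apply, Pi.one_apply, smul_eq_mul]
  push_cast
  linear_combination (4 * (Real.pi : ℂ) ^ 2 * weight ξ ^ 2 * (ξ 0 ^ 2 + ξ 1 ^ 2)) * Complex.I_sq
    - 4 * (Real.pi : ℂ) ^ 2 * h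

theorem opJ_injective : Function.Injective opJ := by
  rw [injective_iff_map_eq_zero]
  intro a ha
  apply fourierOp_injective
  rw [map_zero]
  have h1 : mulOp symJ (fourierOp a) = 0 := by
    rw [← fourierOp_fourierMultiplier]
    change fourierOp (opJ a) = 0
    rw [ha, map_zero]
  apply Lp.ext
  filter_upwards [coeFn_mulOp memLp_symJ (fourierOp a), Lp.coeFn_zero ℂ 2 (volume : Measure Plane)]
    with ξ h2 h3
  rw [h1, h3, Pi.zero_apply, eq_comm, mul_eq_zero] at h2
  rw [h3, Pi.zero_apply]
  exact h2.resolve_left (Complex.ofReal_ne_zero.2 (weight_pos ξ).ne')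

theorem lineDeriv_opJ (i : Fin 2) (a : L2) :
    ∂_{unitVec i} ((opJ a : L2) : 𝓢'(Plane, ℂ)) = (opG i a : L2) := by
  rw [lineDeriv_eq_iff, opG, opJ, fourierOp_fourierMultiplier, fourierOp_fourierMultiplier]
  filter_upwards [coeFn_mulOp memLp_symJ (fourierOp a), coeFn_mulOp (memLp_symG i) (fourierOp a)]
    with ξ h1 h2
  rw [h1, h2, symG, symJ, mul_assoc]

/-- `W^{1,2} ⊆ range J`, with an explicit preimage. -/
theorem eq_opJ_of_lineDeriv {u g₀ g₁ : L2} (h0 : ∂_{unitVec 0} (u : 𝓢'(Plane, ℂ)) = g₀)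
    (h1 : ∂_{unitVec 1} (u : 𝓢'(Plane, ℂ)) = g₁) :
    opJ (opJ u - ((4 * Real.pi ^ 2 : ℝ) : ℂ)⁻¹ • (opG 0 g₀ + opG 1 g₁)) = u := by
  -- the difference of both sides is `f` with `𝓕 f = w² (1 + |ξ|²) 𝓕 u - 𝓕 u = 0`
  rw [lineDeriv_eq_iff] at h0 h1
  apply fourierOp_injective
  set c : ℂ := ((4 * Real.pi ^ 2 : ℝ) : ℂ)⁻¹ with hc
  have hc' : c * (4 * Real.pi ^ 2) = 1 := by
    rw [hc]
    push_cast
    exact inv_mul_cancel₀ (by simp [Real.pi_ne_zero])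
  rw [opJ, fourierOp_fourierMultiplier, map_sub, map_smul, map_add, opG, opG,
    fourierOp_fourierMultiplier, fourierOp_fourierMultiplier, fourierOp_fourierMultiplier]
  apply Lp.ext
  filter_upwards [h0, h1, coeFn_mulOp memLp_symJ (fourierOp u),
    coeFn_mulOp (memLp_symG 0) (fourierOp g₀), coeFn_mulOp (memLp_symG 1) (fourierOp g₁),
    coeFn_mulOp memLp_symJ (mulOp symJ (fourierOp u)
      - c • (mulOp (symG 0) (fourierOp g₀) + mulOp (symG 1) (fourierOp g₁))),
    Lp.coeFn_sub (mulOp symJ (fourierOp u))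
      (c • (mulOp (symG 0) (fourierOp g₀) + mulOp (symG 1) (fourierOp g₁))),
    Lp.coeFn_smul c (mulOp (symG 0) (fourierOp g₀) + mulOp (symG 1) (fourierOp g₁)),
    Lp.coeFn_add (mulOp (symG 0) (fourierOp g₀)) (mulOp (symG 1) (fourierOp g₁))]
    with ξ k0 k1 k2 k3 k4 k5 k6 k7 k8
  rw [k5, k6, Pi.sub_apply, k7, Pi.smul_apply, k8, Pi.add_apply, k2, k3, k4, k0, k1, smul_eq_mul]
  have h : (weight ξ : ℂ) ^ 2 * (1 + ((ξ 0 : ℂ) ^ 2 + (ξ 1 : ℂ) ^ 2)) = 1 := by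
    exact_mod_cast weight_sq_mul' ξ
  simp only [symG, symJ]
  set U := fourierOp u ξ
  linear_combination U * h
    + (weight ξ : ℂ) ^ 2 * (ξ 0 ^ 2 + ξ 1 ^ 2) * U * hc'
    - (4 * c * (Real.pi : ℂ) ^ 2 * weight ξ ^ 2 * (ξ 0 ^ 2 + ξ 1 ^ 2) * U) * Complex.I_sq

theorem weakDeriv_eq_of_lineDeriv {i : Fin 2} {u g : L2}
    (h : ∂_{unitVec i} (u : 𝓢'(Plane, ℂ)) = g) {hu : u ∈ (weakDeriv i).domain} :
    weakDeriv i ⟨u, hu⟩ = g :=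
  toDist_injective ((weakDerivFun_spec i ⟨u, hu⟩).symm.trans h)

theorem opJ_mem_weakDeriv (i : Fin 2) (a : L2) : opJ a ∈ (weakDeriv i).domain :=
  ⟨_, lineDeriv_opJ i a⟩

theorem weakDeriv_opJ (i : Fin 2) (a : L2) {h : opJ a ∈ (weakDeriv i).domain} :
    weakDeriv i ⟨opJ a, h⟩ = opG i a := weakDeriv_eq_of_lineDeriv (lineDeriv_opJ i a)

theorem mem_weakDeriv_inf_iff (u : L2) :
    (u ∈ (weakDeriv 0).domain ∧ u ∈ (weakDeriv 1).domain) ↔ ∃ a, opJ a = u := by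
  constructor
  · rintro ⟨⟨g₀, h0⟩, ⟨g₁, h1⟩⟩
    exact ⟨_, eq_opJ_of_lineDeriv h0 h1⟩
  · rintro ⟨a, rfl⟩
    exact ⟨opJ_mem_weakDeriv 0 a, opJ_mem_weakDeriv 1 a⟩

theorem mem_W22_iff (u : L2) : u ∈ W22 ↔ ∃ c, (opJ * opJ) c = u := by
  constructor
  · rintro ⟨h1, h2⟩
    choose g hg using h1
    have hJ : ∀ j, ∃ b, opJ b = g j := fun j ↦ by
      rw [← mem_weakDeriv_inf_iff]
      obtain ⟨k0, hk0⟩ := h2 0 j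
      obtain ⟨k1, hk1⟩ := h2 1 j
      rw [hg] at hk0 hk1
      exact ⟨⟨k0, hk0⟩, ⟨k1, hk1⟩⟩
    choose b hb using hJ
    refine ⟨u - ((4 * Real.pi ^ 2 : ℝ) : ℂ)⁻¹ • (opG 0 (b 0) + opG 1 (b 1)), ?_⟩
    refine Eq.trans ?_ (eq_opJ_of_lineDeriv (hg 0) (hg 1))
    have e : ∀ i x, opG i (opJ x) = opJ (opG i x) := fun i x ↦ DFunLike.congr_fun (opG_comm_opJ i) x
    rw [← hb, ← hb, e, e, mul_apply_eq_comp, map_sub opJ u, map_smul opJ, map_add opJ]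
  · rintro ⟨c, rfl⟩
    have h1 : ∀ i, ∂_{unitVec i} (((opJ * opJ) c : L2) : 𝓢'(Plane, ℂ)) = (opJ (opG i c) : L2) := by
      intro i
      refine (lineDeriv_opJ i (opJ c)).trans ?_
      rw [show opG i (opJ c) = opJ (opG i c) from DFunLike.congr_fun (opG_comm_opJ i) c]
    exact ⟨fun i ↦ ⟨_, h1 i⟩, fun i j ↦ ⟨opG i (opG j c), by rw [h1, lineDeriv_opJ]⟩⟩

end WeakDerivatives

/-! ### The product rule -/

section ProductRule

open scoped NNReal

theorem ae_lineDifferentiableAt {f : Plane → ℂ} {C : ℝ≥0} (hf : LipschitzWith C f) (v : Plane) :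
    ∀ᵐ p, LineDifferentiableAt ℝ f p v := by
  filter_upwards [hf.ae_differentiableAt] with p hp
  exact hp.lineDifferentiableAt

/-- The difference quotients of a Lipschitz function converge almost everywhere and are bounded. -/
theorem tendsto_integral_slope_mul {f g : Plane → ℂ} {C : ℝ≥0} (hf : LipschitzWith C f)
    (hg : Integrable g) (v : Plane) :
    Tendsto (fun t : ℝ ↦ ∫ x, (t⁻¹ • (f (x + t • v) - f x)) * g x) (𝓝[>] 0)
      (𝓝 (∫ x, lineDeriv ℝ f x v * g x)) := by
  refine tendsto_integral_filter_of_dominated_convergence (fun x ↦ (C * ‖v‖) * ‖g x‖) ?_ ?_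
    (hg.norm.const_mul _) ?_
  · filter_upwards with t
    have := hf.continuous
    exact (Continuous.aestronglyMeasurable (by fun_prop)).mul hg.aestronglyMeasurable
  · filter_upwards [self_mem_nhdsWithin] with t (ht : 0 < t)
    filter_upwards with x
    calc ‖t⁻¹ • (f (x + t • v) - f x) * g x‖
      = (t⁻¹ * ‖f (x + t • v) - f x‖) * ‖g x‖ := by simp [abs_of_pos ht]
    _ ≤ (t⁻¹ * (C * ‖(x + t • v) - x‖)) * ‖g x‖ := by
      gcongr
      exact hf.norm_sub_le (x + t • v) x
    _ = (C * ‖v‖) * ‖g x‖ := by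
      rw [add_sub_cancel_left, norm_smul, Real.norm_of_nonneg ht.le]
      field_simp
  · filter_upwards [ae_lineDifferentiableAt hf v] with x hx
    exact hx.hasLineDerivAt.tendsto_slope_zero_right.mul tendsto_const_nhds

/-- Integration by parts for Lipschitz functions without compact support: both derivatives are
limits of difference quotients, and integrability is enough for dominated convergence. -/
theorem integral_lineDeriv_mul {f g : Plane → ℂ} {C D : ℝ≥0} {M : ℝ} (hf : LipschitzWith C f)
    (hg : LipschitzWith D g) (hfi : Integrable f) (hgi : Integrable g) (hfb : ∀ x, ‖f x‖ ≤ M)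
    (v : Plane) :
    ∫ x, lineDeriv ℝ f x v * g x = -∫ x, f x * lineDeriv ℝ g x v := by
  have hcf := hf.continuous
  have hcg := hg.continuous
  have A := tendsto_integral_slope_mul hf hgi v
  have B := tendsto_integral_slope_mul hg hfi (-v)
  have S1 : ∀ t : ℝ, ∫ x, (t⁻¹ • (f (x + t • v) - f x)) * g x
      = ∫ x, (t⁻¹ • (g (x + t • (-v)) - g x)) * f x := by
    intro t
    have i1 : Integrable fun x ↦ f (x + t • v) * g x :=
      hgi.bdd_mul (hcf.comp (continuous_add_const _)).aestronglyMeasurable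
        (.of_forall fun x ↦ hfb _)
    have i2 : Integrable fun x ↦ f x * g x :=
      hgi.bdd_mul hcf.aestronglyMeasurable (.of_forall hfb)
    have i3 : Integrable fun x ↦ f x * g (x + t • (-v)) :=
      (hgi.comp_add_right _).bdd_mul hcf.aestronglyMeasurable (.of_forall hfb)
    have S2 : ∫ x, (f (x + t • v) - f x) * g x = ∫ x, (g (x + t • (-v)) - g x) * f x := by
      have S3 : ∫ x, f (x + t • v) * g x = ∫ x, f x * g (x + t • (-v)) := by
        rw [← integral_add_right_eq_self _ (t • (-v))]
        simp
      simp_rw [sub_mul, mul_comm (g _)]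
      rw [integral_sub i1 i2, integral_sub i3 i2, S3]
    simp_rw [smul_mul_assoc, integral_smul, S2]
  simp only [S1] at A
  rw [tendsto_nhds_unique A B, ← integral_neg]
  congr with x
  rw [lineDeriv_neg]
  ring

theorem schwartz_lipschitz (U : 𝓢(Plane, ℂ)) : ∃ C : ℝ≥0, LipschitzWith C U := by
  refine ⟨(SchwartzMap.seminorm ℝ 0 1 U).toNNReal,
    lipschitzWith_of_nnnorm_fderiv_le U.differentiable fun x ↦ NNReal.le_toNNReal_of_coe_le ?_⟩
  rw [coe_nnnorm, ← norm_iteratedFDeriv_one]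
  exact SchwartzMap.norm_iteratedFDeriv_le_seminorm ℝ U 1 x

theorem lipschitzWith_mul {E : Type*} [PseudoMetricSpace E] {f g : E → ℂ} {C D M N : ℝ≥0}
    (hf : LipschitzWith C f) (hg : LipschitzWith D g) (hfb : ∀ x, ‖f x‖ ≤ M)
    (hgb : ∀ x, ‖g x‖ ≤ N) : LipschitzWith (C * N + M * D) fun x ↦ f x * g x := by
  refine LipschitzWith.of_dist_le_mul fun x y ↦ ?_
  have h1 := hf.dist_le_mul x y
  have h2 := hg.dist_le_mul x y
  rw [dist_eq_norm] at h1 h2 ⊢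
  have e : f x * g x - f y * g y = (f x - f y) * g x + f y * (g x - g y) := by ring
  rw [e]
  refine (norm_add_le _ _).trans ?_
  rw [norm_mul, norm_mul]
  push_cast
  have h3 := mul_le_mul h1 (hgb x) (norm_nonneg _) (by positivity)
  have h4 := mul_le_mul (hfb y) h2 (norm_nonneg _) (by positivity)
  linarith

/-- A bounded Lipschitz function on the plane. -/
structure BddLipschitz (m : Plane → ℝ) : Prop where
  bdd : ∃ M : ℝ≥0, ∀ p, |m p| ≤ M
  lip : ∃ C : ℝ≥0, LipschitzWith C m

variable {m : Plane → ℝ}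

/-- The operator of multiplication by a real function. -/
noncomputable def realMul (m : Plane → ℝ) : L2 →L[ℂ] L2 := mulOp fun p ↦ (m p : ℂ)

theorem BddLipschitz.memLp (hm : BddLipschitz m) :
    MemLp (fun p ↦ (m p : ℂ)) ∞ (volume : Measure Plane) := by
  obtain ⟨M, hM⟩ := hm.bdd
  obtain ⟨C, hC⟩ := hm.lip
  refine memLp_top_of_bound (C := M) ?_ (.of_forall fun p ↦ by simpa using hM p)
  exact (Complex.continuous_ofReal.comp hC.continuous).aestronglyMeasurable

theorem BddLipschitz.memLp_lineDeriv (hm : BddLipschitz m) (v : Plane) :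
    MemLp (fun p ↦ ((lineDeriv ℝ m p v : ℝ) : ℂ)) ∞ (volume : Measure Plane) := by
  obtain ⟨C, hC⟩ := hm.lip
  exact (hC.memLp_lineDeriv v).ofReal

/-- The product rule in weak form, tested against Schwartz functions. The derivative of `m` exists
almost everywhere by Rademacher's theorem. -/
theorem integral_product_rule (hm : BddLipschitz m) (U V : 𝓢(Plane, ℂ)) (v : Plane) :
    ∫ x, star (∂_{v} V x) * (m x * U x)
      = -∫ x, star (V x) * (m x * ∂_{v} U x + (lineDeriv ℝ m x v : ℝ) * U x) := by
  obtain ⟨M, hM⟩ := hm.bdd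
  obtain ⟨C, hC⟩ := hm.lip
  obtain ⟨D, hD⟩ := schwartz_lipschitz U
  obtain ⟨D', hD'⟩ := schwartz_lipschitz V
  have hN : ∀ x, ‖U x‖ ≤ ((SchwartzMap.seminorm ℝ 0 0 U).toNNReal : ℝ) := by
    intro x
    rw [Real.coe_toNNReal _ (apply_nonneg _ _)]
    exact SchwartzMap.norm_le_seminorm ℝ U x
  have hmC : LipschitzWith C fun x ↦ (m x : ℂ) := by
    simpa [Function.comp_def] using Complex.isometry_ofReal.lipschitz.comp hC
  have hMC : ∀ x, ‖(m x : ℂ)‖ ≤ M := fun x ↦ by simpa using hM x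
  have hf := lipschitzWith_mul hmC hD hMC hN
  have hg : LipschitzWith D' fun x ↦ star (V x) := by
    refine LipschitzWith.of_dist_le_mul fun x y ↦ ?_
    rw [dist_eq_norm, ← star_sub, norm_star, ← dist_eq_norm]
    exact hD'.dist_le_mul x y
  have hfi : Integrable fun x ↦ (m x : ℂ) * U x :=
    U.integrable.bdd_mul hmC.continuous.aestronglyMeasurable (.of_forall hMC)
  have hgi : Integrable fun x ↦ star (V x) := by
    refine V.integrable.mono hg.continuous.aestronglyMeasurable (.of_forall fun x ↦ ?_)
    rw [norm_star]
  have hfb : ∀ x, ‖(m x : ℂ) * U x‖ ≤ M * (SchwartzMap.seminorm ℝ 0 0 U).toNNReal := fun x ↦ by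
    rw [norm_mul]
    exact mul_le_mul (hMC x) (hN x) (norm_nonneg _) (by positivity)
  have key := integral_lineDeriv_mul hf hg hfi hgi hfb v
  have e1 : ∫ x, lineDeriv ℝ (fun x ↦ (m x : ℂ) * U x) x v * star (V x)
      = ∫ x, star (V x) * (m x * ∂_{v} U x + (lineDeriv ℝ m x v : ℝ) * U x) := by
    refine integral_congr_ae ?_
    filter_upwards [hC.ae_lineDifferentiableAt v] with x hx
    have h1 : HasLineDerivAt ℝ (fun x ↦ (m x : ℂ)) ((lineDeriv ℝ m x v : ℝ) : ℂ) x v :=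
      HasDerivAt.ofReal_comp hx.hasLineDerivAt
    have h2 : HasLineDerivAt ℝ U (∂_{v} U x) x v := by
      rw [SchwartzMap.lineDerivOp_apply]
      exact (U.differentiableAt.lineDifferentiableAt).hasLineDerivAt
    have h3 : HasLineDerivAt ℝ (fun x ↦ (m x : ℂ) * U x)
        (((lineDeriv ℝ m x v : ℝ) : ℂ) * U x + m x * ∂_{v} U x) x v := by
      have := HasDerivAt.mul h1 h2
      simpa [HasLineDerivAt, Pi.mul_def] using this
    rw [h3.lineDeriv]
    ring
  have e2 : ∫ x, (m x : ℂ) * U x * lineDeriv ℝ (fun x ↦ star (V x)) x v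
      = ∫ x, star (∂_{v} V x) * (m x * U x) := by
    congr with x
    have h2 : HasLineDerivAt ℝ V (∂_{v} V x) x v := by
      rw [SchwartzMap.lineDerivOp_apply]
      exact (V.differentiableAt.lineDifferentiableAt).hasLineDerivAt
    have h3 : HasLineDerivAt ℝ (fun x ↦ star (V x)) (star (∂_{v} V x)) x v := HasDerivAt.star h2
    rw [h3.lineDeriv]
    ring
  rw [e1, e2] at key
  rw [key, neg_neg]

theorem hasTemperateGrowth_symJ : Function.HasTemperateGrowth symJ := by
  have h : Function.HasTemperateGrowth weight := by
    unfold weight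
    fun_prop
  unfold symJ
  fun_prop

theorem fourierOp_toLp (ψ : 𝓢(Plane, ℂ)) : fourierOp (ψ.toLp 2) = (𝓕 ψ).toLp 2 :=
  SchwartzMap.toLp_fourier_eq ψ

/-- `J` maps Schwartz functions to Schwartz functions. -/
theorem opJ_toLp (ψ : 𝓢(Plane, ℂ)) :
    opJ (ψ.toLp 2) = (SchwartzMap.fourierMultiplierCLM ℂ symJ ψ).toLp 2 := by
  apply fourierOp_injective
  rw [opJ, fourierOp_fourierMultiplier, fourierOp_toLp, fourierOp_toLp,
    SchwartzMap.fourierMultiplierCLM_apply, FourierTransform.fourier_fourierInv_eq]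
  apply Lp.ext
  filter_upwards [coeFn_mulOp memLp_symJ ((𝓕 ψ).toLp 2), (𝓕 ψ).coeFn_toLp 2,
    (SchwartzMap.smulLeftCLM ℂ symJ (𝓕 ψ)).coeFn_toLp 2] with ξ h1 h2 h3
  rw [h1, h2, h3, SchwartzMap.smulLeftCLM_apply_apply hasTemperateGrowth_symJ, smul_eq_mul]

theorem opG_of_opJ_eq (i : Fin 2) {a : L2} {U : 𝓢(Plane, ℂ)} (h : opJ a = U.toLp 2) :
    opG i a = (∂_{unitVec i} U).toLp 2 := by
  apply toDist_injective
  rw [← lineDeriv_opJ, h, Lp.toTemperedDistribution_toLp_eq, Lp.toTemperedDistribution_toLp_eq,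
    TemperedDistribution.lineDerivOp_toTemperedDistributionCLM_eq]

theorem inner_toLp (V : 𝓢(Plane, ℂ)) (f : L2) :
    inner ℂ (V.toLp 2 : L2) f = ∫ x, star (V x) * f x := by
  rw [L2.inner_def]
  refine integral_congr_ae ?_
  filter_upwards [V.coeFn_toLp 2] with x hx
  rw [hx, RCLike.inner_apply, mul_comm]
  rfl

/-- The product rule `∂_i (m u) = m ∂_i u + (∂_i m) u` for `u ∈ W^{1,2}` and a bounded Lipschitz
function `m`, written as an identity between bounded operators. By continuity and because `J`
preserves Schwartz functions, only `integral_product_rule` is needed. -/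
theorem opG_realMul_opJ (hm : BddLipschitz m) (i : Fin 2) :
    opG i * realMul m * opJ = opJ * realMul m * opG i
      + opJ * realMul (fun p ↦ lineDeriv ℝ m p (unitVec i)) * opJ := by
  have hd : DenseRange (SchwartzMap.toLpCLM ℂ (E := Plane) ℂ 2 volume) :=
    SchwartzMap.denseRange_toLpCLM ENNReal.ofNat_ne_top
  refine ContinuousLinearMap.ext fun a ↦ ext_inner_left ℂ fun b ↦ ?_
  induction b using hd.induction_on with
  | hp => exact isClosed_eq (by fun_prop) (by fun_prop)
  | ih V₀ =>
    induction a using hd.induction_on with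
    | hp => exact isClosed_eq (by fun_prop) (by fun_prop)
    | ih U₀ =>
      simp only [SchwartzMap.toLpCLM_apply]
      set a : L2 := U₀.toLp 2 with ha
      set b : L2 := V₀.toLp 2 with hb
      obtain ⟨U, hU⟩ : ∃ U : 𝓢(Plane, ℂ), opJ a = U.toLp 2 := ⟨_, opJ_toLp U₀⟩
      obtain ⟨V, hV⟩ : ∃ V : 𝓢(Plane, ℂ), opJ b = V.toLp 2 := ⟨_, opJ_toLp V₀⟩
      have hGU := opG_of_opJ_eq i hU
      have hGV := opG_of_opJ_eq i hV
      have l1 : inner ℂ b ((opG i * realMul m * opJ) a)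
          = -inner ℂ (opG i b) (realMul m (opJ a)) := by
        rw [← inner_neg_left, ← neg_apply, ← star_opG, inner_star_left]
        rfl
      have l2 : inner ℂ b ((opJ * realMul m * opG i
          + opJ * realMul (fun p ↦ lineDeriv ℝ m p (unitVec i)) * opJ) a)
          = inner ℂ (opJ b) (realMul m (opG i a)
            + realMul (fun p ↦ lineDeriv ℝ m p (unitVec i)) (opJ a)) := by
        rw [← star_opJ, inner_star_left, star_opJ, map_add]
        rfl
      rw [l1, l2, hGU, hGV, hU, hV, inner_toLp, inner_toLp, neg_eq_iff_eq_neg]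
      refine Eq.trans ?_ ((integral_product_rule hm U V (unitVec i)).trans ?_)
      · refine integral_congr_ae ?_
        filter_upwards [coeFn_mulOp hm.memLp (U.toLp 2), U.coeFn_toLp 2] with x h1 h2
        rw [realMul, h1, h2]
      · congr 1
        refine integral_congr_ae ?_
        filter_upwards [coeFn_mulOp hm.memLp ((∂_{unitVec i} U).toLp 2),
          (∂_{unitVec i} U).coeFn_toLp 2,
          coeFn_mulOp (hm.memLp_lineDeriv (unitVec i)) (U.toLp 2), U.coeFn_toLp 2,
          Lp.coeFn_add (realMul m ((∂_{unitVec i} U).toLp 2))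
            (realMul (fun p ↦ lineDeriv ℝ m p (unitVec i)) (U.toLp 2))] with x h1 h2 h3 h4 h5
        rw [h5, Pi.add_apply, realMul, realMul, h1, h2, h3, h4]

end ProductRule

/-! ### Hilbert-Schmidt estimates -/

section HilbertSchmidtEstimate

open scoped NNReal

/-- For `h ∈ L¹ ∩ L²` the inverse Fourier transform in `L²` is given by the integral. -/
theorem star_fourierOp_ae_eq (h : L2) (hi : Integrable h) :
    star fourierOp h =ᵐ[volume] 𝓕⁻ (h : Plane → ℂ) := by
  have hL : Continuous fun p : Plane × Plane ↦ (-innerₗ Plane) p.1 p.2 := by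
    simp only [LinearMap.neg_apply, innerₗ_apply_apply]
    fun_prop
  have hcont : Continuous (𝓕⁻ (h : Plane → ℂ)) :=
    VectorFourier.fourierIntegral_continuous Real.continuous_fourierChar hL hi
  refine ae_eq_of_integral_contDiff_smul_eq ((Lp.memLp _).locallyIntegrable (by norm_num))
    hcont.locallyIntegrable fun g g_smooth g_cpt ↦ ?_
  have hg₁ : HasCompactSupport (Complex.ofRealCLM ∘ g) := g_cpt.comp_left rfl
  have hg₂ : ContDiff ℝ ((⊤ : ℕ∞) : WithTop ℕ∞) (Complex.ofRealCLM ∘ g) := by fun_prop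
  set ψ : 𝓢(Plane, ℂ) := hg₁.toSchwartzMap hg₂ with hψ
  have hψg : ∀ x, ψ x = (g x : ℂ) := fun x ↦ rfl
  have h1 : ∫ x, ψ x • star fourierOp h x = ∫ ξ, (𝓕⁻ ψ) ξ • h ξ := by
    have e : Lp.toTemperedDistribution (star fourierOp h) = 𝓕⁻ (h : 𝓢'(Plane, ℂ)) := by
      rw [Lp.fourierInv_toTemperedDistribution_eq, star_fourierOp]
      rfl
    rw [← Lp.toTemperedDistribution_apply, ← Lp.toTemperedDistribution_apply, e,
      TemperedDistribution.fourierInv_apply]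
  have h2 : ∫ ξ, (𝓕⁻ ψ) ξ • h ξ = ∫ x, ψ x • 𝓕⁻ (h : Plane → ℂ) x := by
    have hflip : (-innerₗ Plane).flip = -innerₗ Plane := by
      ext x y
      simp [real_inner_comm]
    have := VectorFourier.integral_fourierIntegral_smul_eq_flip (μ := volume) (ν := volume)
      (L := -innerₗ Plane) Real.continuous_fourierChar hL ψ.integrable hi
    rw [hflip] at this
    rw [SchwartzMap.fourierInv_coe]
    exact this
  have h3 := h1.trans h2
  simp only [hψg, Complex.coe_smul] at h3
  exact h3

/-- The kernel estimate for operators `f(p) k(-i∇)` with `f, k ∈ L²`: by Bessel's inequality,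
applied for fixed `p` to the functions `ξ ↦ exp(-2πi ξ·p) conj(k(ξ))`. -/
theorem sum_norm_sq_le {f k : Plane → ℂ} (hf : MemLp f ∞ (volume : Measure Plane))
    (hf2 : MemLp f 2 (volume : Measure Plane)) (hk : MemLp k ∞ (volume : Measure Plane))
    (hk2 : MemLp k 2 (volume : Measure Plane)) {ι : Type*} {v : ι → L2} (hv : Orthonormal ℂ v)
    (s : Finset ι) :
    ∑ i ∈ s, ‖(mulOp f * fourierMultiplier k) (v i)‖ ^ 2
      ≤ (∫ p, ‖f p‖ ^ 2) * ‖hk2.toLp k‖ ^ 2 := by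
  have hψ : ∀ x : Plane, MemLp (fun ξ ↦ star ((Real.fourierChar (inner ℝ ξ x) : ℂ) * k ξ)) 2
      (volume : Measure Plane) := by
    intro x
    have hc : Continuous fun ξ : Plane ↦ (Real.fourierChar (inner ℝ ξ x) : ℂ) :=
      continuous_subtype_val.comp (Real.continuous_fourierChar.comp (by fun_prop))
    refine MemLp.star (hk2.of_le (hc.aestronglyMeasurable.mul hk2.1) (.of_forall fun ξ ↦ ?_))
    rw [norm_mul, Circle.norm_coe, one_mul]
  have hψnorm : ∀ x, ‖(hψ x).toLp‖ = ‖hk2.toLp k‖ := by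
    intro x
    rw [Lp.norm_toLp, Lp.norm_toLp]
    congr 1
    refine eLpNorm_congr_norm_ae (.of_forall fun ξ ↦ ?_)
    rw [norm_star, norm_mul, Circle.norm_coe, one_mul]
  have hpt : ∀ a : L2, fourierMultiplier k a
      =ᵐ[volume] fun x ↦ inner ℂ (hψ x).toLp (fourierOp a) := by
    intro a
    have hi : Integrable (mulOp k (fourierOp a)) :=
      (MemLp.integrable_mul hk2 (Lp.memLp (fourierOp a))).congr
        (coeFn_mulOp hk (fourierOp a)).symm
    have h1 : fourierMultiplier k a = star fourierOp (mulOp k (fourierOp a)) := by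
      rw [fourierMultiplier_eq]
      rfl
    rw [h1]
    refine (star_fourierOp_ae_eq _ hi).trans (.of_forall fun x ↦ ?_)
    simp only [Real.fourierInv_eq, L2.inner_def]
    refine integral_congr_ae ?_
    filter_upwards [coeFn_mulOp hk (fourierOp a), (hψ x).coeFn_toLp] with ξ h2 h3
    rw [h2, h3, RCLike.inner_apply, RCLike.star_def, RCLike.conj_conj, Circle.smul_def, smul_eq_mul]
    ring
  have hint := fun i ↦ integrable_norm_sq ((mulOp f * fourierMultiplier k) (v i))
  simp only [norm_sq_eq_integral ((mulOp f * fourierMultiplier k) _)]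
  rw [← integral_finsetSum _ fun i _ ↦ hint i, ← integral_mul_const]
  refine integral_mono_ae (integrable_finsetSum _ fun i _ ↦ hint i)
    ((hf2.integrable_norm_pow (by norm_num)).mul_const _) ?_
  have hall : ∀ i ∈ s, ∀ᵐ p, (mulOp f * fourierMultiplier k) (v i) p
      = f p * inner ℂ (hψ p).toLp (fourierOp (v i)) := by
    intro i _
    filter_upwards [coeFn_mulOp hf (fourierMultiplier k (v i)), hpt (v i)] with p h1 h2
    rw [mul_apply_eq_comp, h1, h2]
  have hort : Orthonormal ℂ fun i ↦ fourierOp (v i) :=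
    hv.comp_linearIsometry (Lp.fourierTransformₗᵢ Plane ℂ).toLinearIsometry
  filter_upwards [(Finset.eventually_all s).2 hall] with p hp
  calc ∑ i ∈ s, ‖(mulOp f * fourierMultiplier k) (v i) p‖ ^ 2
      = ‖f p‖ ^ 2 * ∑ i ∈ s, ‖inner ℂ (fourierOp (v i)) (hψ p).toLp‖ ^ 2 := by
        rw [Finset.mul_sum]
        refine Finset.sum_congr rfl fun i hi ↦ ?_
        rw [hp i hi, norm_mul, mul_pow, norm_inner_symm]
    _ ≤ ‖f p‖ ^ 2 * ‖hk2.toLp k‖ ^ 2 := by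
        gcongr
        rw [← hψnorm p]
        exact hort.sum_inner_products_le _

theorem hsSq_mulOp_fourierMultiplier_ne_top {f k : Plane → ℂ}
    (hf : MemLp f ∞ (volume : Measure Plane))
    (hf2 : MemLp f 2 (volume : Measure Plane)) (hk : MemLp k ∞ (volume : Measure Plane))
    (hk2 : MemLp k 2 (volume : Measure Plane)) {ι : Type*} (b : HilbertBasis ι ℂ L2) :
    hsSq b (mulOp f * fourierMultiplier k) ≠ ∞ := by
  refine ne_top_of_le_ne_top (b := ENNReal.ofReal ((∫ p, ‖f p‖ ^ 2) * ‖hk2.toLp k‖ ^ 2))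
    ENNReal.ofReal_ne_top ?_
  rw [hsSq, ENNReal.tsum_eq_iSup_sum]
  refine iSup_le fun s ↦ ?_
  simp only [← ofReal_norm, ← ENNReal.ofReal_pow (norm_nonneg _)]
  rw [← ENNReal.ofReal_sum_of_nonneg fun _ _ ↦ by positivity]
  exact ENNReal.ofReal_le_ofReal (sum_norm_sq_le hf hf2 hk hk2 b.orthonormal s)

/-- In dimension two the symbol of `J²` is square integrable, that of `J` is not. -/
theorem memLp_symJ_mul_symJ : MemLp (symJ * symJ) 2 (volume : Measure Plane) := by
  have hcont : Continuous (symJ * symJ) := by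
    have := continuous_weight
    unfold symJ
    exact (Complex.continuous_ofReal.comp this).mul (Complex.continuous_ofReal.comp this)
  rw [memLp_two_iff_integrable_sq_norm hcont.aestronglyMeasurable]
  have h := integrable_rpow_neg_one_add_norm_sq (E := Plane) (μ := volume) (r := 4) (by simp; norm_num)
  refine h.congr (.of_forall fun ξ ↦ ?_)
  have h0 : (0 : ℝ) ≤ 1 + ‖ξ‖ ^ 2 := by positivity
  have h1 : ‖(symJ * symJ) ξ‖ ^ 2 = weight ξ ^ 4 := by
    rw [Pi.mul_apply, symJ, norm_mul, Complex.norm_of_nonneg (weight_pos ξ).le]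
    ring
  simp only [h1]
  rw [weight, ← Real.rpow_natCast _ 4, ← Real.rpow_mul h0]
  norm_num

theorem hsSq_mulOp_opJ_ne_top {f : Plane → ℂ} (hf : MemLp f ∞ (volume : Measure Plane))
    (hf2 : MemLp f 2 (volume : Measure Plane)) {ι : Type*} (b : HilbertBasis ι ℂ L2) :
    hsSq b (mulOp f * (opJ * opJ)) ≠ ∞ := by
  rw [opJ, ← fourierMultiplier_mul memLp_symJ memLp_symJ]
  exact hsSq_mulOp_fourierMultiplier_ne_top hf hf2 (memLp_symJ.mul memLp_symJ)
    memLp_symJ_mul_symJ b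

/-- Functions of product form `p ↦ u(t) w(x)` are integrable on the plane if the factors are. -/
theorem integrable_mul_coord {u w : ℝ → ℝ} (hu : Integrable u) (hw : Integrable w) :
    Integrable fun p : Plane ↦ u (p 0) * w (p 1) := by
  have h1 : Integrable fun q : ℝ × ℝ ↦ u q.1 * w q.2 := hu.mul_prod hw
  have h2 := ((volume_preserving_finTwoArrow ℝ).integrable_comp_emb
    (MeasurableEquiv.measurableEmbedding _)).2 h1
  exact ((EuclideanSpace.volume_preserving_symm_measurableEquiv_toLp (Fin 2)).integrable_comp_emb
    (MeasurableEquiv.measurableEmbedding _)).2 h2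

end HilbertSchmidtEstimate

/-! ### Convergence in the trace ideals -/

section Convergence

variable {H : Type*} [NormedAddCommGroup H] [InnerProductSpace ℂ H] [CompleteSpace H]
  {ι : Type*} (b : HilbertBasis ι ℂ H)

theorem schattenNorm_two_lt_top {T : H →L[ℂ] H} (hT : hsSq b T ≠ ∞) : schattenNorm 2 T < ∞ := by
  refine (schattenNorm_two_le b T).trans_lt (ENNReal.rpow_lt_top_of_nonneg (by norm_num) ?_)
  finiteness

theorem tendsto_rpow_four_mul {u : ℕ → ℝ≥0∞} (hu : Tendsto u atTop (𝓝 0)) :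
    Tendsto (fun n ↦ (4 * u n) ^ (1 / 2 : ℝ)) atTop (𝓝 0) := by
  have h1 : Tendsto (fun n ↦ 4 * u n) atTop (𝓝 0) := by
    simpa using ENNReal.Tendsto.const_mul hu (.inr (by norm_num : (4 : ℝ≥0∞) ≠ ∞))
  have h2 := h1.ennrpow_const (1 / 2 : ℝ)
  rwa [ENNReal.zero_rpow_of_pos (by norm_num)] at h2

theorem tendsto_schattenNorm_two {T : ℕ → H →L[ℂ] H}
    (hT : Tendsto (fun n ↦ hsSq b (T n)) atTop (𝓝 0)) :
    Tendsto (fun n ↦ schattenNorm 2 (T n)) atTop (𝓝 0) :=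
  tendsto_of_tendsto_of_tendsto_of_le_of_le tendsto_const_nhds (tendsto_rpow_four_mul hT)
    (fun _ ↦ zero_le) fun n ↦ schattenNorm_two_le b (T n)

theorem schattenNorm_one_mul_lt_top {S T : H →L[ℂ] H} (hS : hsSq b S ≠ ∞) (hT : hsSq b T ≠ ∞) :
    schattenNorm 1 (S * T) < ∞ :=
  (schattenNorm_one_comp_le S T).trans_lt (ENNReal.mul_lt_top (by norm_num)
    (ENNReal.mul_lt_top (schattenNorm_two_lt_top b hS) (schattenNorm_two_lt_top b hT)))

theorem tendsto_schattenNorm_one_mul {S T : ℕ → H →L[ℂ] H} {S' T' : H →L[ℂ] H}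
    (hS' : hsSq b S' ≠ ∞) (hT' : hsSq b T' ≠ ∞)
    (hS : Tendsto (fun n ↦ hsSq b (S n - S')) atTop (𝓝 0))
    (hT : Tendsto (fun n ↦ hsSq b (T n - T')) atTop (𝓝 0)) :
    Tendsto (fun n ↦ schattenNorm 1 (S n * T n - S' * T')) atTop (𝓝 0) := by
  have hs := tendsto_schattenNorm_two b hS
  have ht := tendsto_schattenNorm_two b hT
  set σ : ℕ → ℝ≥0∞ := fun n ↦ schattenNorm 2 (S n - S')
  set τ : ℕ → ℝ≥0∞ := fun n ↦ schattenNorm 2 (T n - T')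
  set σ' := schattenNorm 2 S'
  set τ' := schattenNorm 2 T'
  have hσ' : σ' ≠ ∞ := (schattenNorm_two_lt_top b hS').ne
  have hτ' : τ' ≠ ∞ := (schattenNorm_two_lt_top b hT').ne
  -- `S T - S' T' = (S - S') (T - T') + ((S - S') T' + S' (T - T'))`
  have hle : ∀ n, schattenNorm 1 (S n * T n - S' * T')
      ≤ 2 * (2 * (σ n * τ n) + 2 * (2 * (σ n * τ') + 2 * (σ' * τ n))) := fun n ↦ by
    have e : S n * T n - S' * T'
        = (S n - S') * (T n - T') + ((S n - S') * T' + S' * (T n - T')) := by noncomm_ring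
    rw [e]
    refine (schattenNorm_one_add_le _ _).trans ?_
    gcongr
    · exact schattenNorm_one_comp_le _ _
    · refine (schattenNorm_one_add_le _ _).trans ?_
      gcongr
      · exact schattenNorm_one_comp_le _ _
      · exact schattenNorm_one_comp_le _ _
  have h1 : Tendsto (fun n ↦ σ n * τ n) atTop (𝓝 0) := by
    simpa using ENNReal.Tendsto.mul hs (.inr (by simp)) ht (.inr (by simp))
  have h2 : Tendsto (fun n ↦ σ n * τ') atTop (𝓝 0) := by
    simpa using ENNReal.Tendsto.mul_const hs (.inr hτ')
  have h3 : Tendsto (fun n ↦ σ' * τ n) atTop (𝓝 0) := by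
    simpa using ENNReal.Tendsto.const_mul ht (.inr hσ')
  have two : ∀ {u : ℕ → ℝ≥0∞}, Tendsto u atTop (𝓝 0) → Tendsto (fun n ↦ 2 * u n) atTop (𝓝 0) := by
    intro u hu
    simpa using ENNReal.Tendsto.const_mul hu (.inr (by norm_num : (2 : ℝ≥0∞) ≠ ∞))
  have add0 : ∀ {u w : ℕ → ℝ≥0∞}, Tendsto u atTop (𝓝 0) → Tendsto w atTop (𝓝 0) →
      Tendsto (fun n ↦ u n + w n) atTop (𝓝 0) := fun hu hw ↦ by simpa using hu.add hw
  have key := two (add0 (two h1) (two (add0 (two h2) (two h3))))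
  exact tendsto_of_tendsto_of_tendsto_of_le_of_le tendsto_const_nhds key
    (fun _ ↦ zero_le) hle

/-- Left multiplication by a strongly convergent sequence preserves convergence in the
Hilbert-Schmidt norm. -/
theorem tendsto_hsSq_mul {X : ℕ → H →L[ℂ] H} {Y : H →L[ℂ] H} {T : ℕ → H →L[ℂ] H} {S : H →L[ℂ] H}
    (hT : StrongStarTendsto T S) (hY : hsSq b Y ≠ ∞)
    (hX : Tendsto (fun n ↦ hsSq b (X n - Y)) atTop (𝓝 0)) :
    Tendsto (fun n ↦ hsSq b (T n * X n - S * Y)) atTop (𝓝 0) := by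
  obtain ⟨C, hC⟩ := hT.bdd
  have hle : ∀ n, hsSq b (T n * X n - S * Y)
      ≤ 2 * (ENNReal.ofReal C ^ 2 * hsSq b (X n - Y) + hsSq b (T n * Y - S * Y)) := fun n ↦ by
    have e : T n * X n - S * Y = T n * (X n - Y) + (T n * Y - S * Y) := by noncomm_ring
    rw [e]
    refine (hsSq_add_le b _ _).trans ?_
    gcongr
    refine (hsSq_comp_le b _ _).trans ?_
    gcongr
    rw [← ofReal_norm]
    exact ENNReal.ofReal_le_ofReal (hC n)
  have h1 : Tendsto (fun n ↦ ENNReal.ofReal C ^ 2 * hsSq b (X n - Y)) atTop (𝓝 0) := by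
    simpa using ENNReal.Tendsto.const_mul hX (.inr (by finiteness))
  have h2 := h1.add (tendsto_hsSq_mul_left b hT hY)
  have h3 := ENNReal.Tendsto.const_mul h2 (.inr (by norm_num : (2 : ℝ≥0∞) ≠ ∞))
  simp only [add_zero, mul_zero] at h3
  exact tendsto_of_tendsto_of_tendsto_of_le_of_le tendsto_const_nhds h3 (fun _ ↦ zero_le) hle

namespace IsModel

variable {κ : ℝ} {J G B C F X : H →L[ℂ] H} {z : ℂ}

/-- If `F J²` is Hilbert-Schmidt, then so is `F X (D* D - z)⁻¹` for `X` commuting with `J`. -/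
theorem hsSq_mul_modelRes_ne_top (h : IsModel κ J G B C)
    (hz : z ∉ ((fun r : ℝ ↦ (r : ℂ)) '' Set.Ici 0)) (hX : X * J = J * X)
    (hF : hsSq b (F * (J * J)) ≠ ∞) : hsSq b (F * X * modelRes J G B z) ≠ ∞ := by
  have e : F * X * modelRes J G B z = F * (J * J) * (X * regOp κ J G B C z) := by
    rw [h.modelRes_eq hz]
    simp only [← mul_assoc]
    rw [mul_assoc F X J, hX, ← mul_assoc F J X, mul_assoc (F * J) X J, hX, ← mul_assoc]
  rw [e]
  refine ne_top_of_le_ne_top ?_ (hsSq_comp_le' b (F * (J * J)) (X * regOp κ J G B C z))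
  finiteness

/-- Convergence of `F X_n (D_n* D_n - z)⁻¹` in the Hilbert-Schmidt norm: the factor `F J²` does not
depend on `n`, and what is left of the resolvents converges strongly. -/
theorem tendsto_hsSq_mul_modelRes {Bn Cn Xn : ℕ → H →L[ℂ] H} (h : IsModel κ J G B C)
    (hn : ∀ n, IsModel κ J G (Bn n) (Cn n)) (hB : StrongStarTendsto Bn B)
    (hC : StrongStarTendsto Cn C) (hz : z ∉ ((fun r : ℝ ↦ (r : ℂ)) '' Set.Ici 0))
    (hX : StrongStarTendsto Xn 1) (hXJ : ∀ n, Xn n * J = J * Xn n)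
    (hF : hsSq b (F * (J * J)) ≠ ∞) :
    Tendsto (fun n ↦ hsSq b (F * Xn n * modelRes J G (Bn n) z - F * modelRes J G B z)) atTop
      (𝓝 0) := by
  have hT := hX.mul (h.strongStarTendsto_regOp hn hB hC hz)
  refine (tendsto_hsSq_mul_right b hT hF).congr fun n ↦ ?_
  rw [(hn n).modelRes_eq hz, h.modelRes_eq hz, one_mul]
  simp only [← mul_assoc]
  rw [mul_assoc F (Xn n) J, hXJ, ← mul_assoc F J, mul_assoc (F * J) (Xn n) J, hXJ, ← mul_assoc]

/-- If `F J²` is Hilbert-Schmidt, then so is the adjoint of `F X (D* D - z̄)⁻¹`. -/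
theorem hsSq_modelRes_mul_ne_top (h : IsModel κ J G B C)
    (hz : z ∉ ((fun r : ℝ ↦ (r : ℂ)) '' Set.Ici 0)) (hX : X * J = J * X)
    (hF : hsSq b (F * (J * J)) ≠ ∞) (hFs : star F = F) (hXs : star X = X) :
    hsSq b (modelRes J G B z * X * F) ≠ ∞ := by
  have h1 := h.hsSq_mul_modelRes_ne_top b (star_notMem_Ici hz) hX hF
  rwa [← hsSq_adjoint, ← ContinuousLinearMap.star_eq_adjoint, star_mul, star_mul,
    h.star_modelRes, star_star, hFs, hXs, ← mul_assoc] at h1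

end IsModel

end Convergence

/-! ### The potential -/

section Potential

open scoped NNReal

theorem continuous_of_absolutelyContinuous {f : ℝ → ℝ}
    (hf : ∀ a b : ℝ, AbsolutelyContinuousOnInterval f a b) : Continuous f := by
  rw [continuous_iff_continuousAt]
  intro x
  refine (hf (x - 1) (x + 1)).continuousOn.continuousAt ?_
  rw [Set.uIcc_of_le (by linarith)]
  exact Icc_mem_nhds (by linarith) (by linarith)

theorem lipschitz_of_absolutelyContinuous {f : ℝ → ℝ}
    (hf : ∀ a b : ℝ, AbsolutelyContinuousOnInterval f a b) (hf' : MemLp (deriv f) ∞ volume) :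
    ∃ C : ℝ≥0, LipschitzWith C f := by
  refine ⟨(eLpNormEssSup (deriv f) volume).toNNReal, LipschitzWith.of_dist_le_mul fun x y ↦ ?_⟩
  have hfin : eLpNormEssSup (deriv f) volume ≠ ∞ := by
    rw [← eLpNorm_exponent_top]
    exact hf'.eLpNorm_ne_top
  have hae : ∀ᵐ t, ‖deriv f t‖ ≤ ((eLpNormEssSup (deriv f) volume).toNNReal : ℝ) := by
    filter_upwards [ae_le_eLpNormEssSup (f := deriv f) (μ := volume)] with t ht
    rw [← coe_nnnorm, NNReal.coe_le_coe, ← ENNReal.coe_le_coe, ENNReal.coe_toNNReal hfin]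
    exact ht
  rw [dist_comm, dist_comm x, dist_eq_norm, ← (hf x y).integral_deriv_eq_sub, Real.dist_eq]
  exact intervalIntegral.norm_integral_le_of_norm_le_const_ae (hae.mono fun t ht _ ↦ ht)

/-- For a continuous function the essential bound holds everywhere. -/
theorem bounded_of_memLp_top {f : ℝ → ℝ} (hc : Continuous f) (hf : MemLp f ∞ volume) :
    ∃ M : ℝ≥0, ∀ x, |f x| ≤ M := by
  refine ⟨(eLpNormEssSup f volume).toNNReal, fun x ↦ ?_⟩
  have hfin : eLpNormEssSup f volume ≠ ∞ := by
    rw [← eLpNorm_exponent_top]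
    exact hf.eLpNorm_ne_top
  have hae : ∀ᵐ t, |f t| ≤ ((eLpNormEssSup f volume).toNNReal : ℝ) := by
    filter_upwards [ae_le_eLpNormEssSup (f := f) (μ := volume)] with t ht
    rw [← Real.norm_eq_abs, ← coe_nnnorm, NNReal.coe_le_coe, ← ENNReal.coe_le_coe,
      ENNReal.coe_toNNReal hfin]
    exact ht
  -- the exceptional set is open and null
  have hopen : IsOpen {t | ((eLpNormEssSup f volume).toNNReal : ℝ) < |f t|} :=
    isOpen_lt continuous_const hc.abs
  have hnull : volume {t | ((eLpNormEssSup f volume).toNNReal : ℝ) < |f t|} = 0 := by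
    rw [ae_iff] at hae
    simpa using hae
  have hempty := (hopen.measure_eq_zero_iff volume).1 hnull
  by_contra! hx
  exact (hempty ▸ (show x ∈ {t | ((eLpNormEssSup f volume).toNNReal : ℝ) < |f t|} from hx) :
    x ∈ (∅ : Set ℝ))

/-- The potential `θ(t) φ(x)`. -/
noncomputable def pot (φ θ : ℝ → ℝ) (p : Plane) : ℝ := θ (p 0) * φ (p 1)

/-- The derivative `θ'(t) φ(x)` of the potential in `t`. -/
noncomputable def pot' (φ θ : ℝ → ℝ) (p : Plane) : ℝ := deriv θ (p 0) * φ (p 1)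

variable {φ θ : ℝ → ℝ}

theorem abs_coord_sub_le (p q : Plane) (i : Fin 2) : |p i - q i| ≤ dist p q := by
  rw [dist_eq_norm]
  exact PiLp.norm_apply_le (p - q) i

theorem Hyp.bddLipschitz (hyp : Hyp φ θ) : BddLipschitz (pot φ θ) := by
  obtain ⟨C, hC⟩ := lipschitz_of_absolutelyContinuous hyp.phi_ac hyp.phi'_bdd
  obtain ⟨D, hD⟩ := lipschitz_of_absolutelyContinuous hyp.theta_ac hyp.theta'_bdd
  obtain ⟨M, hM⟩ := bounded_of_memLp_top hC.continuous hyp.phi_bdd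
  obtain ⟨N, hN⟩ := bounded_of_memLp_top hD.continuous hyp.theta_bdd
  refine ⟨⟨N * M, fun p ↦ ?_⟩, ⟨D * M + N * C, LipschitzWith.of_dist_le_mul fun p q ↦ ?_⟩⟩
  · rw [pot, abs_mul]
    push_cast
    exact mul_le_mul (hN _) (hM _) (abs_nonneg _) (by positivity)
  · have h1 : |θ (p 0) - θ (q 0)| ≤ D * dist p q := by
      refine (hD.dist_le_mul (p 0) (q 0)).trans ?_
      rw [Real.dist_eq]
      gcongr
      exact abs_coord_sub_le p q 0
    have h2 : |φ (p 1) - φ (q 1)| ≤ C * dist p q := by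
      refine (hC.dist_le_mul (p 1) (q 1)).trans ?_
      rw [Real.dist_eq]
      gcongr
      exact abs_coord_sub_le p q 1
    have e : pot φ θ p - pot φ θ q
        = (θ (p 0) - θ (q 0)) * φ (p 1) + θ (q 0) * (φ (p 1) - φ (q 1)) := by
      rw [pot, pot]
      ring
    rw [Real.dist_eq, e]
    refine (abs_add_le _ _).trans ?_
    rw [abs_mul, abs_mul]
    push_cast
    have h3 := mul_le_mul h1 (hM (p 1)) (abs_nonneg _) (by positivity)
    have h4 := mul_le_mul (hN (q 0)) h2 (abs_nonneg _) (by positivity)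
    linarith

theorem lineDeriv_pot (p : Plane) : lineDeriv ℝ (pot φ θ) p (unitVec 0) = pot' φ θ p := by
  have h : ∀ t : ℝ, pot φ θ (p + t • unitVec 0) = θ (p 0 + t) * φ (p 1) := fun t ↦ by
    simp [pot, unitVec]
  simp only [lineDeriv, h, pot']
  rw [deriv_mul_const_field, deriv_comp_const_add, add_zero]

theorem continuous_pot_right (hyp : Hyp φ θ) : Continuous fun p : Plane ↦ φ (p 1) :=
  (continuous_of_absolutelyContinuous hyp.phi_ac).comp (by fun_prop)

theorem measurable_pot' (hyp : Hyp φ θ) : Measurable (pot' φ θ) :=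
  ((measurable_deriv θ).comp (by fun_prop)).mul (continuous_pot_right hyp).measurable

theorem Hyp.exists_abs_pot'_le (hyp : Hyp φ θ) : ∃ M : ℝ, ∀ p, |pot' φ θ p| ≤ M := by
  obtain ⟨D, hD⟩ := hyp.bddLipschitz.lip
  refine ⟨D * ‖unitVec 0‖, fun p ↦ ?_⟩
  rw [← lineDeriv_pot]
  exact norm_lineDeriv_le_of_lipschitz ℝ hD

theorem Hyp.integrable_pot' (hyp : Hyp φ θ) : Integrable (pot' φ θ) :=
  integrable_mul_coord (memLp_one_iff_integrable.1 hyp.theta'_int)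
    (memLp_one_iff_integrable.1 hyp.phi_int)

/-- A function whose square is dominated by a bounded integrable function is bounded and square
integrable. -/
theorem memLp_of_sq_le {w : Plane → ℝ} {f : Plane → ℂ} {M : ℝ} (hw : Integrable w)
    (hM : ∀ p, |w p| ≤ M) (hf : AEStronglyMeasurable f (volume : Measure Plane)) {c : ℝ}
    (hc : 0 ≤ c) (hfw : ∀ p, ‖f p‖ ^ 2 ≤ c * |w p|) :
    MemLp f ∞ (volume : Measure Plane) ∧ MemLp f 2 (volume : Measure Plane) := by
  constructor
  · refine memLp_top_of_bound hf (Real.sqrt (c * M)) (.of_forall fun p ↦ ?_)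
    refine Real.le_sqrt_of_sq_le ((hfw p).trans ?_)
    gcongr
    exact hM p
  · rw [memLp_two_iff_integrable_sq_norm hf]
    refine (hw.norm.const_mul c).mono' (hf.norm.pow 2) (.of_forall fun p ↦ ?_)
    rw [Real.norm_of_nonneg (by positivity), Real.norm_eq_abs]
    exact hfw p

end Potential

/-! ### The operators of the model -/

section Model

variable {φ θ : ℝ → ℝ} {B B₀ B₁ : L2 →L[ℂ] L2}

/-- The bounded operator `(∓ d/dt + A₋) J` for `s = ±1`. -/
noncomputable def opGs (s : ℂ) : L2 →L[ℂ] L2 := -(s • opG 0) - Complex.I • opG 1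

theorem star_opGs {s : ℂ} (hs : s = 1 ∨ s = -1) : star (opGs s) = opGs (-s) := by
  rw [opGs, opGs, star_sub, star_neg, star_smul, star_smul, star_opG, star_opG]
  rcases hs with rfl | rfl <;> simp

/-- `B` is a bounded self-adjoint operator that satisfies the product rules
`∂_0 B u = B ∂_0 u + B₀ u` and `∂_1 B u = B ∂_1 u + B₁ u` for `u ∈ W^{1,2}`. -/
structure IsPotential (B B₀ B₁ : L2 →L[ℂ] L2) : Prop where
  star_eq : star B = B
  comm_zero : opG 0 * B * opJ = opJ * B * opG 0 + opJ * B₀ * opJ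
  comm_one : opG 1 * B * opJ = opJ * B * opG 1 + opJ * B₁ * opJ

/-- Both signs of the `t`-derivative give a model; the commutator of `D₀* = s ∂_0 - i ∂_1` with
`B` is `s B₀ - i B₁`. -/
theorem IsPotential.isModel (h : IsPotential B B₀ B₁) {s : ℂ} (hs : s = 1 ∨ s = -1) :
    IsModel (4 * Real.pi ^ 2) opJ (opGs s) B (s • B₀ - Complex.I • B₁) := by
  have hss : s * s = 1 := by rcases hs with rfl | rfl <;> norm_num
  have hG : ∀ r : ℂ, r * r = 1 → opGs (-r) * opGs r
      = (((4 * Real.pi ^ 2 : ℝ) : ℂ)) • (1 - opJ * opJ) := by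
    intro r hr
    have h1 : opGs (-r) * opGs r = -(opG 0 * opG 0 + opG 1 * opG 1) := by
      simp only [opGs, neg_smul, neg_neg, mul_sub, sub_mul, mul_neg, smul_mul_assoc, mul_smul_comm,
        smul_sub, smul_smul, opG_comm 1 0, hr, Complex.I_mul_I, one_smul, mul_comm Complex.I r]
      abel
    rw [h1, opG_sq_add, neg_smul, neg_neg]
  refine ⟨by positivity, star_opJ, opJ_injective, h.star_eq, ?_, ?_, ?_, ?_⟩
  · rw [star_opGs hs]
    exact hG s hss
  · rw [star_opGs hs]
    simpa using hG (-s) (by simpa using hss)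
  · simp only [opGs, sub_mul, mul_sub, neg_mul, mul_neg, smul_mul_assoc, mul_smul_comm,
      opG_comm_opJ]
  · rw [star_opGs hs]
    simp only [opGs, neg_smul, neg_neg, sub_mul, mul_sub, smul_mul_assoc, mul_smul_comm,
      h.comm_zero, h.comm_one, smul_add]
    abel

theorem Hyp.isPotential (hyp : Hyp φ θ) : IsPotential (opB φ θ) (opB' φ θ)
    (realMul fun p ↦ lineDeriv ℝ (pot φ θ) p (unitVec 1)) := by
  have hm := hyp.bddLipschitz
  refine ⟨?_, ?_, opG_realMul_opJ hm 1⟩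
  · rw [opB]
    refine (star_mulOp hm.memLp).trans ?_
    congr with p
    simp [pot]
  · have h := opG_realMul_opJ hm 0
    have e : (fun p ↦ lineDeriv ℝ (pot φ θ) p (unitVec 0)) = pot' φ θ := funext lineDeriv_pot
    rw [e] at h
    exact h

theorem chi_mem_Icc (n : ℕ) (ν : ℝ) : chi n ν ∈ Set.Icc (0 : ℝ) 1 := by
  refine ⟨by unfold chi; positivity, div_le_one_of_le₀ ?_ (Real.sqrt_nonneg _)⟩
  exact Real.le_sqrt_of_sq_le (by nlinarith [sq_nonneg ν])

theorem tendsto_chi (ν : ℝ) : Tendsto (fun n ↦ chi n ν) atTop (𝓝 1) := by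
  have h1 : Tendsto (fun n : ℕ ↦ (Real.sqrt ((ν / n) ^ 2 + 1))⁻¹) atTop (𝓝 1) := by
    have h := ((((tendsto_const_div_atTop_nhds_zero_nat ν).pow 2).add_const 1).sqrt).inv₀
      (by norm_num)
    simpa using h
  refine h1.congr' ?_
  filter_upwards [eventually_gt_atTop 0] with n hn
  have hn' : (0 : ℝ) < n := by exact_mod_cast hn
  have e : ν ^ 2 + (n : ℝ) ^ 2 = n ^ 2 * ((ν / n) ^ 2 + 1) := by field_simp
  rw [chi, e, Real.sqrt_mul (by positivity), Real.sqrt_sq hn'.le, div_mul_eq_div_div,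
    div_self hn'.ne', one_div]

theorem norm_chi_le (n : ℕ) (ν : ℝ) : ‖(chi n ν : ℂ)‖ ≤ 1 := by
  rw [Complex.norm_of_nonneg (chi_mem_Icc n ν).1]
  exact (chi_mem_Icc n ν).2

theorem memLp_chi (n : ℕ) :
    MemLp (fun ξ : Plane ↦ (chi n (2 * Real.pi * ξ 1) : ℂ)) ∞ (volume : Measure Plane) := by
  refine memLp_top_of_bound (C := 1) ?_ (.of_forall fun ξ ↦ norm_chi_le n _)
  refine Measurable.aestronglyMeasurable ?_
  unfold chi
  fun_prop

theorem star_chiA (n : ℕ) : star (chiA n) = chiA n := by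
  rw [chiA, star_fourierMultiplier (memLp_chi n)]
  congr with ξ
  simp

theorem chiA_comm_opJ (n : ℕ) : chiA n * opJ = opJ * chiA n :=
  fourierMultiplier_comm (memLp_chi n) memLp_symJ

theorem chiA_comm_opG (n : ℕ) (i : Fin 2) : chiA n * opG i = opG i * chiA n :=
  fourierMultiplier_comm (memLp_chi n) (memLp_symG i)

theorem strongStarTendsto_chiA : StrongStarTendsto chiA 1 := by
  rw [← fourierMultiplier_one]
  refine strongStarTendsto_fourierMultiplier (C := 2) (C' := 1) memLp_chi memLp_top_one
    (fun n ξ ↦ norm_chi_le n _) (fun n ξ ↦ ?_) fun ξ ↦ ?_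
  · refine (norm_sub_le _ _).trans ?_
    have := norm_chi_le n (2 * Real.pi * ξ 1)
    simp only [Pi.one_apply, norm_one]
    linarith
  · exact (Complex.continuous_ofReal.tendsto 1).comp (tendsto_chi _)

/-- Smoothing by `χ_n(A₋)` commutes with the derivatives. -/
theorem IsPotential.chiA_conj (h : IsPotential B B₀ B₁) (n : ℕ) :
    IsPotential (chiA n * B * chiA n) (chiA n * B₀ * chiA n) (chiA n * B₁ * chiA n) := by
  have key : ∀ (i : Fin 2) (D : L2 →L[ℂ] L2), opG i * B * opJ = opJ * B * opG i + opJ * D * opJ →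
      opG i * (chiA n * B * chiA n) * opJ
        = opJ * (chiA n * B * chiA n) * opG i + opJ * (chiA n * D * chiA n) * opJ := by
    intro i D hD
    calc opG i * (chiA n * B * chiA n) * opJ = opG i * chiA n * B * (chiA n * opJ) := by
          simp only [mul_assoc]
      _ = chiA n * (opG i * B * opJ) * chiA n := by
          rw [chiA_comm_opJ, ← chiA_comm_opG]
          simp only [mul_assoc]
      _ = chiA n * opJ * B * (opG i * chiA n) + chiA n * opJ * D * (opJ * chiA n) := by
          rw [hD, mul_add, add_mul]
          simp only [mul_assoc]
      _ = _ := by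
          rw [← chiA_comm_opG, chiA_comm_opJ]
          simp only [mul_assoc]
          rw [← chiA_comm_opJ]
  refine ⟨?_, key 0 B₀ h.comm_zero, key 1 B₁ h.comm_one⟩
  rw [star_mul, star_mul, star_chiA, h.star_eq, mul_assoc]

theorem strongStarTendsto_chiA_conj (B : L2 →L[ℂ] L2) :
    StrongStarTendsto (fun n ↦ chiA n * B * chiA n) B := by
  simpa using (strongStarTendsto_chiA.mul (.const B)).mul strongStarTendsto_chiA

theorem weakDeriv_of_eq {i : Fin 2} {a x : L2} (hx : opJ a = x) {h : x ∈ (weakDeriv i).domain} :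
    weakDeriv i ⟨x, h⟩ = opG i a := by
  subst hx
  exact weakDeriv_opJ i a

theorem hasGraph_opD (φ θ : ℝ → ℝ) :
    HasGraph (opD φ θ) opJ (opGs (-1) + opB φ θ * opJ) := by
  refine ⟨fun u ↦ ?_, fun a h ↦ ?_⟩
  · rw [← mem_weakDeriv_inf_iff]
    exact ⟨fun h ↦ ⟨h.1, h.2.1⟩, fun h ↦ ⟨h.1, h.2, trivial⟩⟩
  · have e : opD φ θ ⟨opJ a, h⟩ = weakDeriv 0 ⟨opJ a, opJ_mem_weakDeriv 0 a⟩
        + (-Complex.I • weakDeriv 1 ⟨opJ a, opJ_mem_weakDeriv 1 a⟩ + opB φ θ (opJ a)) := rfl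
    rw [e, weakDeriv_opJ, weakDeriv_opJ, opGs]
    simp only [add_apply, sub_apply, smul_apply, mul_apply_eq_comp, neg_smul, one_smul, neg_neg]
    abel

/-- A potential maps `W^{1,2}` to itself. -/
theorem IsPotential.exists_opJ_eq (h : IsPotential B B₀ B₁) (x : L2) :
    ∃ a, opJ a = B (opJ x) ∧ opG 0 a = B (opG 0 x) + B₀ (opJ x) ∧
      opG 1 a = B (opG 1 x) + B₁ (opJ x) := by
  -- `4π² y = 4π² J² y - G₀² y - G₁² y` by `opG_sq_add`, and each term is in the range of `J`
  set y := B (opJ x) with hy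
  have e0 : opG 0 y = opJ (B (opG 0 x) + B₀ (opJ x)) := by
    rw [map_add]
    exact DFunLike.congr_fun h.comm_zero x
  have e1 : opG 1 y = opJ (B (opG 1 x) + B₁ (opJ x)) := by
    rw [map_add]
    exact DFunLike.congr_fun h.comm_one x
  have eG : ∀ i v, opG i (opJ v) = opJ (opG i v) :=
    fun i v ↦ DFunLike.congr_fun (opG_comm_opJ i) v
  set c : ℂ := ((4 * Real.pi ^ 2 : ℝ) : ℂ) with hc
  have hc0 : c ≠ 0 := by
    rw [hc, Complex.ofReal_ne_zero]
    positivity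
  have hy2 : opG 0 (opG 0 y) + opG 1 (opG 1 y) = -c • (y - opJ (opJ y)) :=
    DFunLike.congr_fun opG_sq_add y
  set a := opJ y - c⁻¹ • (opG 0 (B (opG 0 x) + B₀ (opJ x)) + opG 1 (B (opG 1 x) + B₁ (opJ x)))
    with ha
  have hay : opJ a = y := by
    rw [e0, e1, eG, eG, ← map_add] at hy2
    rw [ha, map_sub, map_smul, hy2, smul_smul, mul_neg, inv_mul_cancel₀ hc0, neg_one_smul]
    abel
  refine ⟨a, hay, opJ_injective ?_, opJ_injective ?_⟩
  · rw [← eG, hay, e0]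
  · rw [← eG, hay, e1]

/-- The bounded operator `(H₀ + B A₋ + A₋ B + B² + s B₀) J²`, where `A₋ = -i ∂_1` and the product
rule has been applied to `A₋ B`. With `s = (-1)^j` and the smoothed potential this is
`H_{j,n} J²`. -/
noncomputable def schrodingerJ (s : ℂ) (B B₀ B₁ : L2 →L[ℂ] L2) : L2 →L[ℂ] L2 :=
  -(opG 0 * opG 0) - opG 1 * opG 1 - Complex.I • (B * opG 1 * opJ)
    - Complex.I • (B * opG 1 * opJ + B₁ * opJ * opJ) + B * B * opJ * opJ + s • (B₀ * opJ * opJ)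

/-- Factorization of the second order operator: for `D = -s d/dt + A₋ + B` one has
`D* D = H₀ + B A₋ + A₋ B + B² + s B₀`. -/
theorem opJ_mul_schrodingerJ (h : IsPotential B B₀ B₁) {s : ℂ} (hs : s = 1 ∨ s = -1) (z : ℂ) :
    opJ * schrodingerJ s B B₀ B₁
      = formOp opJ (opGs s) B z * opJ + z • (opJ * opJ * opJ) := by
  have hm := h.isModel hs
  have h1 : opG 1 * opJ = opJ * opG 1 := opG_comm_opJ 1
  have h2 : star (opGs s) * opGs s = -(opG 0 * opG 0) - opG 1 * opG 1 := by
    rw [hm.star_G_mul_G, ← neg_inj, ← neg_smul, ← opG_sq_add]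
    abel
  have hGG : (-(opG 0 * opG 0) - opG 1 * opG 1) * opJ
      = opJ * (-(opG 0 * opG 0) - opG 1 * opG 1) := by
    have hi : ∀ i, opG i * opG i * opJ = opJ * (opG i * opG i) := fun i ↦ by
      rw [mul_assoc, opG_comm_opJ, ← mul_assoc, opG_comm_opJ, mul_assoc]
    rw [sub_mul, mul_sub, neg_mul, mul_neg, hi, hi]
  have hstar : star (opGs s) = s • opG 0 - Complex.I • opG 1 := by
    rw [star_opGs hs, opGs, neg_smul, neg_neg]
  have hform : formOp opJ (opGs s) B z = (-(opG 0 * opG 0) - opG 1 * opG 1)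
      + (opJ * B * (s • opG 0 - Complex.I • opG 1) + opJ * (s • B₀ - Complex.I • B₁) * opJ)
      + opJ * B * opGs s + opJ * B * B * opJ - z • (opJ * opJ) := by
    rw [formOp, hm.star_add_mul, add_mul, mul_add, mul_add, h2, ← mul_assoc, hm.comm, hstar]
    simp only [mul_assoc]
    abel
  rw [hform, sub_mul, add_mul, add_mul, add_mul, hGG, schrodingerJ, opGs]
  simp only [mul_add, mul_sub, add_mul, sub_mul, neg_mul, mul_neg, smul_mul_assoc, mul_smul_comm,
    mul_assoc, smul_add]
  abel

/-- The domain of the sum is `W^{2,2}`, because the other summands are defined there by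
`IsPotential.exists_opJ_eq`. -/
theorem hasGraph_opHn (hyp : Hyp φ θ) (j n : ℕ) :
    HasGraph (opHn φ θ j n) (opJ * opJ) (schrodingerJ ((-1) ^ j) (opBn φ θ n) (opBn' φ θ n)
      (chiA n * (realMul fun p ↦ lineDeriv ℝ (pot φ θ) p (unitVec 1)) * chiA n)) := by
  have hP : IsPotential (opBn φ θ n) (opBn' φ θ n)
      (chiA n * (realMul fun p ↦ lineDeriv ℝ (pot φ θ) p (unitVec 1)) * chiA n) :=
    hyp.isPotential.chiA_conj n
  set B₁ := chiA n * (realMul fun p ↦ lineDeriv ℝ (pot φ θ) p (unitVec 1)) * chiA n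
  have eG : ∀ i v, opG i (opJ v) = opJ (opG i v) :=
    fun i v ↦ DFunLike.congr_fun (opG_comm_opJ i) v
  -- membership in the domains of the summands
  have m1 : ∀ i c, opJ (opJ c) ∈ (opComp (weakDeriv i) (weakDeriv i)).domain := fun i c ↦
    mem_opComp_domain.2 ⟨opJ_mem_weakDeriv i _, by
      rw [weakDeriv_opJ, eG]
      exact opJ_mem_weakDeriv i _⟩
  have v1 : ∀ i c (h : opJ (opJ c) ∈ (opComp (weakDeriv i) (weakDeriv i)).domain),
      opComp (weakDeriv i) (weakDeriv i) ⟨opJ (opJ c), h⟩ = opG i (opG i c) := fun i c h ↦ by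
    obtain ⟨h1, h2⟩ := mem_opComp_domain.1 h
    rw [opComp_apply _ _ h1 h2]
    exact weakDeriv_of_eq (by rw [weakDeriv_opJ, eG])
  have memA : ∀ a, opJ a ∈ opA.domain := fun a ↦ opJ_mem_weakDeriv 1 a
  have vA : ∀ {a x} (hx : opJ a = x) (h : x ∈ opA.domain),
      opA ⟨x, h⟩ = -Complex.I • opG 1 a := fun hx h ↦
    congrArg (-Complex.I • ·) (weakDeriv_of_eq (i := 1) hx (h := h))
  have mA : ∀ c, opJ (opJ c) ∈ (opComp opA opA).domain := fun c ↦
    mem_opComp_domain.2 ⟨memA _, by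
      rw [vA rfl, eG, ← map_smul]
      exact memA _⟩
  have vAA : ∀ c (h : opJ (opJ c) ∈ (opComp opA opA).domain),
      opComp opA opA ⟨opJ (opJ c), h⟩ = -opG 1 (opG 1 c) := fun c h ↦ by
    obtain ⟨h1, h2⟩ := mem_opComp_domain.1 h
    rw [opComp_apply _ _ h1 h2]
    rw [vA (a := -Complex.I • opG 1 c) (by rw [vA rfl, eG, map_smul]), map_smul, smul_smul]
    simp
  have mBA : ∀ c, opJ (opJ c) ∈ (opComp (ofBounded (opBn φ θ n)) opA).domain := fun c ↦
    mem_opComp_domain.2 ⟨memA _, trivial⟩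
  have vBA : ∀ c (h : opJ (opJ c) ∈ (opComp (ofBounded (opBn φ θ n)) opA).domain),
      opComp (ofBounded (opBn φ θ n)) opA ⟨opJ (opJ c), h⟩
        = -Complex.I • opBn φ θ n (opG 1 (opJ c)) := fun c h ↦ by
    obtain ⟨h1, h2⟩ := mem_opComp_domain.1 h
    rw [opComp_apply _ _ h1 h2]
    change opBn φ θ n (opA ⟨_, h1⟩) = _
    rw [vA rfl, map_smul]
  have mAB : ∀ c, opJ (opJ c) ∈ (opComp opA (ofBounded (opBn φ θ n))).domain := fun c ↦ by
    obtain ⟨a, ha, -⟩ := hP.exists_opJ_eq (opJ c)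
    refine mem_opComp_domain.2 ⟨trivial, ?_⟩
    change opBn φ θ n (opJ (opJ c)) ∈ opA.domain
    rw [← ha]
    exact memA a
  have vAB : ∀ c (h : opJ (opJ c) ∈ (opComp opA (ofBounded (opBn φ θ n))).domain),
      opComp opA (ofBounded (opBn φ θ n)) ⟨opJ (opJ c), h⟩
        = -Complex.I • (opBn φ θ n (opG 1 (opJ c)) + B₁ (opJ (opJ c))) := fun c h ↦ by
    obtain ⟨h1, h2⟩ := mem_opComp_domain.1 h
    obtain ⟨a, ha, -, ha1⟩ := hP.exists_opJ_eq (opJ c)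
    rw [opComp_apply _ _ h1 h2, ← ha1]
    exact vA ha _
  refine ⟨fun u ↦ ?_, fun c h ↦ ?_⟩
  · rw [← mem_W22_iff]
    constructor
    · intro hu
      exact hu.1.1.1.1.1
    · intro hu
      obtain ⟨c, rfl⟩ := (mem_W22_iff u).1 hu
      exact ⟨⟨⟨⟨⟨hu, m1 0 c, mA c⟩, mBA c⟩, mAB c⟩, trivial⟩, trivial⟩
  · have e : opHn φ θ j n ⟨(opJ * opJ) c, h⟩
        = -opComp (weakDeriv 0) (weakDeriv 0) ⟨opJ (opJ c), m1 0 c⟩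
          + opComp opA opA ⟨opJ (opJ c), mA c⟩
          + opComp (ofBounded (opBn φ θ n)) opA ⟨opJ (opJ c), mBA c⟩
          + opComp opA (ofBounded (opBn φ θ n)) ⟨opJ (opJ c), mAB c⟩
          + opBn φ θ n (opBn φ θ n (opJ (opJ c)))
          + ((-1 : ℂ) ^ j) • opBn' φ θ n (opJ (opJ c)) := rfl
    rw [e, v1, vAA, vBA, vAB, schrodingerJ]
    simp only [add_apply, sub_apply, neg_apply, smul_apply, mul_apply_eq_comp, neg_smul]
    abel

end Model

/-! ### The resolvents -/

section Resolvents

variable {φ θ : ℝ → ℝ} {z : ℂ}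

theorem neg_one_pow_eq {j : ℕ} (hj : j = 1 ∨ j = 2) :
    ((-1 : ℂ) ^ j = 1 ∨ (-1 : ℂ) ^ j = -1) := by
  rcases hj with rfl | rfl <;> norm_num

/-- Here `(-1)^j` is the sign for which `(d/dt + A₋) J = opGs (-1)` belongs to `D`, that is `j = 1`,
and its adjoint `opGs 1` to `D*`, that is `j = 2`. -/
theorem isResolvent_opH (hyp : Hyp φ θ) {j : ℕ} (hj : j = 1 ∨ j = 2)
    (hz : z ∉ ((fun r : ℝ ↦ (r : ℂ)) '' Set.Ici 0)) :
    IsResolvent (opH φ θ j) z (modelRes opJ (opGs ((-1) ^ j)) (opB φ θ) z) := by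
  have hD := hasGraph_opD φ θ
  have hm := hyp.isPotential.isModel (s := -1) (.inr rfl)
  have hD' := hm.hasGraph_adjoint hD
  rcases hj with rfl | rfl
  · rw [opH, if_pos rfl, pow_one]
    exact hm.isResolvent_opComp hD hD' hz
  -- for `j = 2` the adjoint of `D` takes the place of `D`, which reverses the sign of `d/dt`
  · rw [opH, if_neg (by norm_num), neg_one_sq]
    rw [star_opGs (.inr rfl), neg_neg] at hD'
    rw [← star_opGs (.inl rfl)] at hD
    exact (hyp.isPotential.isModel (.inl rfl)).isResolvent_opComp hD' hD hz

theorem isModel_opBn (hyp : Hyp φ θ) {s : ℂ} (hs : s = 1 ∨ s = -1) (n : ℕ) :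
    IsModel (4 * Real.pi ^ 2) opJ (opGs s) (opBn φ θ n) (s • opBn' φ θ n - Complex.I •
      (chiA n * (realMul fun p ↦ lineDeriv ℝ (pot φ θ) p (unitVec 1)) * chiA n)) :=
  (hyp.isPotential.chiA_conj n).isModel hs

theorem isResolvent_opHn (hyp : Hyp φ θ) {j : ℕ} (hj : j = 1 ∨ j = 2)
    (hz : z ∉ ((fun r : ℝ ↦ (r : ℂ)) '' Set.Ici 0)) (n : ℕ) :
    IsResolvent (opHn φ θ j n) z (modelRes opJ (opGs ((-1) ^ j)) (opBn φ θ n) z) :=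
  (isModel_opBn hyp (neg_one_pow_eq hj) n).isResolvent_of_hasGraph (hasGraph_opHn hyp j n)
    (opJ_mul_schrodingerJ (hyp.isPotential.chiA_conj n) (neg_one_pow_eq hj) z) hz

theorem tendsto_hsSq_mul_chiA_mul_modelRes (hyp : Hyp φ θ) {s : ℂ} (hs : s = 1 ∨ s = -1)
    (hz : z ∉ ((fun r : ℝ ↦ (r : ℂ)) '' Set.Ici 0)) {ι : Type*} (b : HilbertBasis ι ℂ L2)
    {F : L2 →L[ℂ] L2} (hF : hsSq b (F * (opJ * opJ)) ≠ ∞) :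
    Tendsto (fun n ↦ hsSq b (F * chiA n * modelRes opJ (opGs s) (opBn φ θ n) z
      - F * modelRes opJ (opGs s) (opB φ θ) z)) atTop (𝓝 0) :=
  (hyp.isPotential.isModel hs).tendsto_hsSq_mul_modelRes b (isModel_opBn hyp hs)
    (strongStarTendsto_chiA_conj _)
    (((strongStarTendsto_chiA_conj _).smul s).sub ((strongStarTendsto_chiA_conj _).smul _)) hz
    strongStarTendsto_chiA chiA_comm_opJ hF

theorem Hyp.memLp_pot' (hyp : Hyp φ θ) :
    MemLp (fun p ↦ (pot' φ θ p : ℂ)) ∞ (volume : Measure Plane) ∧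
      MemLp (fun p ↦ (pot' φ θ p : ℂ)) 2 (volume : Measure Plane) := by
  obtain ⟨M, hM⟩ := hyp.exists_abs_pot'_le
  refine memLp_of_sq_le hyp.integrable_pot' hM
    (Complex.measurable_ofReal.comp (measurable_pot' hyp)).aestronglyMeasurable
    ((abs_nonneg _).trans (hM 0)) fun p ↦ ?_
  rw [Complex.norm_real, Real.norm_eq_abs, sq]
  exact mul_le_mul_of_nonneg_right (hM p) (abs_nonneg _)

/-- The symmetric factorization `2 B' = g f` with `|f|² = |B'|` and `|g|² = 4 |B'|`. -/
theorem exists_factorization (hyp : Hyp φ θ) : ∃ g f : L2 →L[ℂ] L2,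
    (2 : ℂ) • opB' φ θ = g * f ∧ star g = g ∧
      ∀ {ι : Type} (b : HilbertBasis ι ℂ L2),
        hsSq b (g * (opJ * opJ)) ≠ ∞ ∧ hsSq b (f * (opJ * opJ)) ≠ ∞ := by
  obtain ⟨M, hM⟩ := hyp.exists_abs_pot'_le
  have hw := hyp.integrable_pot'
  have hmeas := measurable_pot' hyp
  have hsqrt : Measurable fun p ↦ Real.sqrt |pot' φ θ p| := by fun_prop
  set f : Plane → ℂ := fun p ↦ (Real.sqrt |pot' φ θ p| : ℂ) with hf
  -- the division by zero on the zero set of `B'` yields the value `0`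
  set g : Plane → ℂ := fun p ↦ ((2 * (pot' φ θ p / Real.sqrt |pot' φ θ p|) : ℝ) : ℂ) with hg
  have hfm : Measurable f := Complex.measurable_ofReal.comp hsqrt
  have hgm : Measurable g := Complex.measurable_ofReal.comp ((hmeas.div hsqrt).const_mul 2)
  obtain ⟨hf1, hf2⟩ := memLp_of_sq_le hw hM hfm.aestronglyMeasurable zero_le_one fun p ↦ by
    rw [hf, Complex.norm_of_nonneg (Real.sqrt_nonneg _), Real.sq_sqrt (abs_nonneg _), one_mul]
  obtain ⟨hg1, hg2⟩ := memLp_of_sq_le hw hM hgm.aestronglyMeasurable zero_le_four fun p ↦ by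
    rw [hg, Complex.norm_real, Real.norm_eq_abs, sq_abs, mul_pow, div_pow,
      Real.sq_sqrt (abs_nonneg _), ← sq_abs (pot' φ θ p), sq |pot' φ θ p|, mul_self_div_self]
    norm_num
  have hfg : (2 : ℂ) • (fun p ↦ (pot' φ θ p : ℂ)) = g * f := by
    funext p
    rw [Pi.smul_apply, Pi.mul_apply, hf, hg, smul_eq_mul, ← Complex.ofReal_mul, mul_assoc,
      div_mul_cancel_of_imp, Complex.ofReal_mul, Complex.ofReal_ofNat]
    intro h0
    rwa [Real.sqrt_eq_zero (abs_nonneg _), abs_eq_zero] at h0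
  refine ⟨mulOp g, mulOp f, ?_, ?_, fun b ↦
    ⟨hsSq_mulOp_opJ_ne_top hg1 hg2 b, hsSq_mulOp_opJ_ne_top hf1 hf2 b⟩⟩
  · rw [← mulOp_mul hg1 hf1, ← hfg]
    exact (mulOp_smul 2 (hyp.memLp_pot').1).symm
  · rw [star_mulOp hg1]
    congr with p
    exact Complex.conj_ofReal _

theorem hsSq_opB'_ne_top (hyp : Hyp φ θ) {ι : Type*} (b : HilbertBasis ι ℂ L2) :
    hsSq b (opB' φ θ * (opJ * opJ)) ≠ ∞ :=
  hsSq_mulOp_opJ_ne_top hyp.memLp_pot'.1 hyp.memLp_pot'.2 b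

/-- Convergence of the left factor in the trace norm limit, by passing to adjoints. -/
theorem tendsto_hsSq_modelRes_mul (hyp : Hyp φ θ) {s : ℂ} (hs : s = 1 ∨ s = -1)
    (hz : z ∉ ((fun r : ℝ ↦ (r : ℂ)) '' Set.Ici 0)) {ι : Type*} (b : HilbertBasis ι ℂ L2)
    {F : L2 →L[ℂ] L2} (hF : hsSq b (F * (opJ * opJ)) ≠ ∞) (hFs : star F = F) :
    Tendsto (fun n ↦ hsSq b (modelRes opJ (opGs s) (opBn φ θ n) z * chiA n * F
      - modelRes opJ (opGs s) (opB φ θ) z * F)) atTop (𝓝 0) := by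
  refine (tendsto_hsSq_mul_chiA_mul_modelRes hyp hs (star_notMem_Ici hz) b hF).congr fun n ↦ ?_
  rw [← hsSq_adjoint, ← ContinuousLinearMap.star_eq_adjoint, star_sub, star_mul, star_mul, star_mul,
    (isModel_opBn hyp hs n).star_modelRes, (hyp.isPotential.isModel hs).star_modelRes, star_star,
    hFs, star_chiA, mul_assoc]

end Resolvents

end DiracSchrodinger

theorem mainTheorem4 (φ θ : ℝ → ℝ) (hyp : Hyp φ θ) (z z' : ℂ)
    (hz : z ∉ ((fun r : ℝ ↦ (r : ℂ)) '' Set.Ici 0))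
    (hz' : z' ∉ ((fun r : ℝ ↦ (r : ℂ)) '' Set.Ici 0))
    (j : ℕ) (hj : j = 1 ∨ j = 2) :
    -- the resolvents at `z` and `z'` exist
    (∀ w ∈ ({z, z'} : Set ℂ), w ∈ resSet (opH φ θ j) ∧
      ∀ n : ℕ, 1 ≤ n → w ∈ resSet (opHn φ θ j n)) ∧
    -- convergence in the Hilbert-Schmidt norm
    (schattenNorm 2 (opB' φ θ ∘L resolventOp (opH φ θ j) z) < ∞ ∧
      (∀ n : ℕ, 1 ≤ n → schattenNorm 2 (opBn' φ θ n ∘L resolventOp (opHn φ θ j n) z) < ∞) ∧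
      Tendsto (fun n : ℕ ↦ schattenNorm 2
        (opBn' φ θ n ∘L resolventOp (opHn φ θ j n) z -
          opB' φ θ ∘L resolventOp (opH φ θ j) z)) atTop (𝓝 0)) ∧
    -- convergence in the trace norm
    (schattenNorm 1
        (resolventOp (opH φ θ j) z ∘L ((2 : ℂ) • opB' φ θ) ∘L resolventOp (opH φ θ j) z') < ∞ ∧
      (∀ n : ℕ, 1 ≤ n → schattenNorm 1
        (resolventOp (opHn φ θ j n) z ∘L ((2 : ℂ) • opBn' φ θ n) ∘L
          resolventOp (opHn φ θ j n) z') < ∞) ∧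
      Tendsto (fun n : ℕ ↦ schattenNorm 1
        (resolventOp (opHn φ θ j n) z ∘L ((2 : ℂ) • opBn' φ θ n) ∘L
            resolventOp (opHn φ θ j n) z' -
          resolventOp (opH φ θ j) z ∘L ((2 : ℂ) • opB' φ θ) ∘L
            resolventOp (opH φ θ j) z')) atTop (𝓝 0)) := by
  obtain ⟨_, b, -⟩ := exists_hilbertBasis ℂ L2
  have hs := neg_one_pow_eq hj
  have hm := hyp.isPotential.isModel hs
  have hmn := isModel_opBn hyp hs
  have hB' := hsSq_opB'_ne_top hyp b
  have hR : ∀ {w : ℂ}, w ∉ ((fun r : ℝ ↦ (r : ℂ)) '' Set.Ici 0) → _ := fun hw ↦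
    (isResolvent_opH hyp hj hw).resolventOp_eq
  have hRn : ∀ {w : ℂ}, w ∉ ((fun r : ℝ ↦ (r : ℂ)) '' Set.Ici 0) → _ := fun hw ↦
    fun n ↦ (isResolvent_opHn hyp hj hw n).resolventOp_eq
  refine ⟨?_, ?_, ?_⟩
  · rintro w (rfl | rfl)
    · exact ⟨⟨_, isResolvent_opH hyp hj hz⟩, fun n _ ↦ ⟨_, isResolvent_opHn hyp hj hz n⟩⟩
    · exact ⟨⟨_, isResolvent_opH hyp hj hz'⟩, fun n _ ↦ ⟨_, isResolvent_opHn hyp hj hz' n⟩⟩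
  · simp only [hR hz, hRn hz]
    have hlim : hsSq b (opB' φ θ * modelRes opJ (opGs ((-1) ^ j)) (opB φ θ) z) ≠ ∞ := by
      simpa using hm.hsSq_mul_modelRes_ne_top b hz (X := 1) (by simp) hB'
    have en : ∀ n, opBn' φ θ n ∘L modelRes opJ (opGs ((-1) ^ j)) (opBn φ θ n) z
        = chiA n * (opB' φ θ * chiA n * modelRes opJ (opGs ((-1) ^ j)) (opBn φ θ n) z) :=
      fun n ↦ rfl
    have e : opB' φ θ ∘L modelRes opJ (opGs ((-1) ^ j)) (opB φ θ) z
        = 1 * (opB' φ θ * modelRes opJ (opGs ((-1) ^ j)) (opB φ θ) z) := (one_mul _).symm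
    -- the factor `1` matches the strong limit of the left factor `χ_n(A₋)`
    simp only [e, en]
    refine ⟨schattenNorm_two_lt_top b (by rwa [one_mul]), fun n _ ↦ schattenNorm_two_lt_top b ?_,
      tendsto_schattenNorm_two b (tendsto_hsSq_mul b strongStarTendsto_chiA hlim
        (tendsto_hsSq_mul_chiA_mul_modelRes hyp hs hz b hB'))⟩
    have h1 := (hmn n).hsSq_mul_modelRes_ne_top b hz (chiA_comm_opJ n) hB'
    exact ne_top_of_le_ne_top (ENNReal.mul_ne_top (by finiteness) h1) (hsSq_comp_le b (chiA n) _)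
  · simp only [hR hz, hRn hz, hR hz', hRn hz']
    obtain ⟨g, f, hgf, hgs, hHS⟩ := exists_factorization hyp
    obtain ⟨hg, hf⟩ := hHS b
    have e : modelRes opJ (opGs ((-1) ^ j)) (opB φ θ) z ∘L ((2 : ℂ) • opB' φ θ) ∘L
          modelRes opJ (opGs ((-1) ^ j)) (opB φ θ) z'
        = (modelRes opJ (opGs ((-1) ^ j)) (opB φ θ) z * g) *
          (f * modelRes opJ (opGs ((-1) ^ j)) (opB φ θ) z') := by
      rw [hgf]
      rfl
    have en : ∀ n, modelRes opJ (opGs ((-1) ^ j)) (opBn φ θ n) z ∘L ((2 : ℂ) • opBn' φ θ n) ∘L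
          modelRes opJ (opGs ((-1) ^ j)) (opBn φ θ n) z'
        = (modelRes opJ (opGs ((-1) ^ j)) (opBn φ θ n) z * chiA n * g) *
          (f * chiA n * modelRes opJ (opGs ((-1) ^ j)) (opBn φ θ n) z') := fun n ↦ by
      have e2 : (2 : ℂ) • opBn' φ θ n = chiA n * (g * f) * chiA n := by
        rw [← hgf, mul_smul_comm, smul_mul_assoc]
        rfl
      rw [e2]
      rfl
    simp only [e, en]
    have hl : hsSq b (modelRes opJ (opGs ((-1) ^ j)) (opB φ θ) z * g) ≠ ∞ := by
      simpa using hm.hsSq_modelRes_mul_ne_top b hz (X := 1) (by simp) hg hgs (star_one _)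
    have hr : hsSq b (f * modelRes opJ (opGs ((-1) ^ j)) (opB φ θ) z') ≠ ∞ := by
      simpa using hm.hsSq_mul_modelRes_ne_top b hz' (X := 1) (by simp) hf
    exact ⟨schattenNorm_one_mul_lt_top b hl hr,
      fun n _ ↦ schattenNorm_one_mul_lt_top b
        ((hmn n).hsSq_modelRes_mul_ne_top b hz (chiA_comm_opJ n) hg hgs (star_chiA n))
        ((hmn n).hsSq_mul_modelRes_ne_top b hz' (chiA_comm_opJ n) hf),
      tendsto_schattenNorm_one_mul b hl hr (tendsto_hsSq_modelRes_mul hyp hs hz b hg hgs)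
        (tendsto_hsSq_mul_chiA_mul_modelRes hyp hs hz' b hf)⟩
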